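/- For an odd prime $N$ let $\Phi_N(x)=x^{N-1}+\cdots+x+1$, $R=\mathbb{R}[x]/\langle x^N-1\rangle$ and $O=\mathbb{Z}[x]/\langle\Phi_N\rangle\cong\mathbb{Z}[\zeta]$, where $\zeta=e^{2\pi i/N}$, and let $\Psi\colon R\to \mathbb{R}[x]/\langle\Phi_N\rangle$ be the quotient map; $O$ is regarded as a subring of $\mathbb{R}[x]/\langle\Phi_N\rangle$. An element $\sum_{i=0}^{N-1}c_i x^i$ of $R$ is called binary if $c_i=\pm\frac12$ for all $0\le i\le N-1$ and its image under $\Psi$ is nonzero. An element of $O$ is called binary if it is the image under $\Psi$ of a binary element of $R$ (equivalently, it is nonzero and its coefficients in the basis $\zeta,\ldots,\zeta^{N-1}$ either all lie in $\{0,1\}$ or all lie in $\{0,-1\}$). The norm of $\alpha\in O$ is $\mathcal{N}(\alpha)=\prod_{j=1}^{N-1}\sigma_j(\alpha)$, where $\sigma_j\colon O\to\mathbb{C}$ is the ring homomorphism with $\sigma_j(\zeta)=\zeta^j$. Let $\beta$ be uniformly distributed on the finite set of binary elements of $O$. Then the expectation of the random variable $S=\log\mathcal{N}(\beta)$ satisfies,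 as $N\to\infty$ through the odd primes, $$\mathrm{E}(S)=\frac12\left(\log\left(\frac N4\right)-\gamma\right)N+o(N),$$ where $\gamma=0.577215\ldots$ is Euler's constant. -/

import Mathlib

open Polynomial

noncomputable section

namespace BitRetrieval

/-- `R = ℝ[x]/⟨x^N - 1⟩`: real cyclic sequences of length `N`, with cyclic convolution. -/
abbrev R (N : ℕ) : Type := AdjoinRoot (X ^ N - 1 : ℝ[X])

/-- The quotient `R/⟨Φ_N⟩ = ℝ[x]/⟨Φ_N⟩`. -/
abbrev RQuot (N : ℕ) : Type := AdjoinRoot (cyclotomic N ℝ)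

/-- `O = ℤ[x]/⟨Φ_N⟩`, the ring of integers of the cyclotomic field of `N`th roots of unity. -/
abbrev O (N : ℕ) : Type := AdjoinRoot (cyclotomic N ℤ)

/-- `O` is countable; it carries the discrete σ-algebra. -/
instance (N : ℕ) : MeasurableSpace (O N) := ⊤

/-- The quotient map `Ψ : R → R/⟨Φ_N⟩`. -/
def Psi (N : ℕ) : R N →+* RQuot N :=
  AdjoinRoot.lift (AdjoinRoot.of (cyclotomic N ℝ)) (AdjoinRoot.root (cyclotomic N ℝ)) (by
    have h : AdjoinRoot.mk (cyclotomic N ℝ) (X ^ N - 1) = 0 :=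
      AdjoinRoot.mk_eq_zero.mpr (cyclotomic.dvd_X_pow_sub_one N ℝ)
    simpa using h)

/-- The canonical map `O → R/⟨Φ_N⟩`, sending `ζ` to the class of `x`. -/
def toRQuot (N : ℕ) : O N →+* RQuot N :=
  AdjoinRoot.lift (Int.castRingHom (RQuot N)) (AdjoinRoot.root (cyclotomic N ℝ)) (by
    have e : Int.castRingHom (RQuot N) =
        (AdjoinRoot.of (cyclotomic N ℝ)).comp (Int.castRingHom ℝ) := RingHom.ext_int _ _
    rw [e, ← eval₂_map, map_cyclotomic_int]
    exact AdjoinRoot.eval₂_root _)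

/-- The binary elements of `R`: all `N` components in the basis `1, x, …, x^(N-1)` are `±1/2`, and
the image under `Ψ` is nonzero. -/
def binaryR (N : ℕ) : Set (R N) :=
  {b | (∃ c : Fin N → ℝ, (∀ i, c i = 1 / 2 ∨ c i = -(1 / 2)) ∧
      b = ∑ i, c i • AdjoinRoot.root (X ^ N - 1 : ℝ[X]) ^ (i : ℕ)) ∧ Psi N b ≠ 0}

/-- The binary elements of `O`: the elements of `O` that are the image under `Ψ` of a binary
element of `R`. -/
def binaryO (N : ℕ) : Set (O N) :=
  {b | ∃ bR ∈ binaryR N, toRQuot N b = Psi N bR}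

/-- The conjugate maps `σ_j`, viewed as embeddings `O → ℂ` with `σ_j ζ = exp(2πi j/N)`, for `j`
prime to `N` modulo `N` (that is, `1 ≤ j ≤ N - 1` when `N` is prime). -/
def sigma (N : ℕ) [NeZero N] (j : (ZMod N)ˣ) : O N →+* ℂ :=
  AdjoinRoot.lift (Int.castRingHom ℂ)
    (Complex.exp (2 * Real.pi * Complex.I * ((j : ZMod N).val / N))) (by
    have h := Complex.isPrimitiveRoot_exp_of_coprime (j : ZMod N).val N (NeZero.ne N)
      (ZMod.val_coe_unit_coprime j)
    have h2 := h.isRoot_cyclotomic (NeZero.pos N)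
    rw [← map_cyclotomic_int N ℂ, IsRoot.def, eval_map] at h2
    exact h2)

/-- The norm `𝒩(α) = ∏_j σ_j(α)`, as a real number (the product is real, see `coe_algNorm`). -/
def algNorm (N : ℕ) [NeZero N] (a : O N) : ℝ := (∏ j : (ZMod N)ˣ, sigma N j a).re

/-- `σ_{-j}` is `σ_j` followed by complex conjugation. -/
theorem sigma_neg (N : ℕ) [NeZero N] (j : (ZMod N)ˣ) (a : O N) :
    sigma N (-j) a = (starRingEnd ℂ) (sigma N j a) := by
  have key : sigma N (-j) = (starRingEnd ℂ).comp (sigma N j) := by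
    apply AdjoinRoot.ringHom_ext
    · exact Subsingleton.elim _ _
    · simp only [sigma, RingHom.comp_apply, AdjoinRoot.lift_root]
      rw [← Complex.exp_conj]
      have hN : (N : ℂ) ≠ 0 := by exact_mod_cast NeZero.ne N
      have hd : ((((-j : (ZMod N)ˣ) : ZMod N).val + (j : ZMod N).val : ℕ) : ZMod N) = 0 := by
        simp
      obtain ⟨m, hm⟩ := (ZMod.natCast_eq_zero_iff _ _).mp hd
      have hm' : ((((-j : (ZMod N)ˣ) : ZMod N).val : ℂ) + ((j : ZMod N).val : ℂ)) = N * m := by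
        exact_mod_cast hm
      rw [Complex.exp_eq_exp_iff_exists_int]
      refine ⟨m, ?_⟩
      have h3 : (((-j : (ZMod N)ˣ) : ZMod N).val : ℂ) = N * m - ((j : ZMod N).val : ℂ) :=
        eq_sub_of_add_eq hm'
      rw [h3]
      simp only [map_mul, map_div₀, map_natCast, Complex.conj_I, Complex.conj_ofReal, map_ofNat,
        Int.cast_natCast]
      field_simp
      ring
  rw [key]; rfl

/-- The product of the conjugates is a real number. -/
theorem coe_algNorm (N : ℕ) [NeZero N] (a : O N) :
    (algNorm N a : ℂ) = ∏ j : (ZMod N)ˣ, sigma N j a := by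
  unfold algNorm
  rw [← Complex.conj_eq_iff_re, map_prod]
  exact Fintype.prod_equiv (Equiv.neg _) _ _ fun j => (sigma_neg N j a).symm

end BitRetrieval

end

/-!
Write the conjugates of a binary element as half of a signed sum `X = ∑ ε_k ζ ^ k` over the `N`th
roots of unity. For prime `N` the binary elements correspond bijectively to the `2 ^ N - 2`
nonconstant sign patterns `ε` (`binaryO_eq_image`, `binaryElt_injOn`), and since multiplication of
exponents by `j` permutes the patterns, all `N - 1` conjugates have the same distribution. So the
expectation is `(N - 1) / 2` times the mean of `log (|X| ^ 2 / N) + log (N / 4)`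
(`integral_log_algNorm`), and it remains to see that the mean of `log w`, where `w = |X| ^ 2 / N`,
tends to `-γ` (`eventually_abs_meanLogEnergy_add_le`). Heuristically, `w` is asymptotically a
standard exponential variable, whose logarithm has mean `Γ'(1) = -γ`; the difficulty is the
singularity of the logarithm at `0`.

By Frullani's formula `log w = ∫ (exp (-u) - exp (-u w)) / u du` over `(0, ∞)`, everything is
expressed through the Laplace transform `L(u)` of `w`, and the limit of the mean is the integral of
`(exp (-u) - 1 / (1 + u)) / u`, which is `-γ` (`integral_exp_neg_sub_inv_div`). Because a Gaussian is
the Fourier transform of a Gaussian, `L(u)` is the Gaussian average over `g` in `ℂ` of the product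
`∏ cos (Re (v ζ ^ k))`, where `v` is the complex conjugate of `g` times `2 √(u / N)`
(`laplace_eq_integral`). Comparing cosines with Gaussians gives `L(u) → 1 / (1 + u)`
(`tendsto_laplace`) and `1 - L(u) = O(u)` (`one_sub_laplace_le`).

For dominated convergence one also needs `L(u) = O(1 / u)`, uniformly for `1 ≤ u ≤ N ^ 2`
(`laplace_le_div`). Here the product of cosines must be small also when `v` is large. It is at most
`exp (-Q(v) / 2)` with `Q(v) = ∑ sin² (Re (v ζ ^ k))`, and `Q(v (ζ ^ j - 1)) ≤ 4 Q(v)`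
(`sum_sin_sq_phase_sub_le`); choosing `j` such that `v (ζ ^ j - 1)` has size about `1`, where
`sin² x` is comparable to `x ^ 2`, shows that `Q(v)` is of order `N` for `1 ≤ |v| ≤ N / 4`.

For `u > N ^ 2` arithmetic takes over: the norm of a nonzero element is a nonzero integer, so no
conjugate is smaller than `N ^ (-N)`, up to a constant (`one_le_pow_mul_energy`). The part `u > N ^ 2`
of Frullani's integral is therefore at most `O(N log N)` times `L(N ^ 2) = O(N ^ (-2))`
(`abs_integral_tail_le`).
-/

open MeasureTheory Set Filter Topology

/-! ### Laplace-type integrals for the logarithm and for Euler's constant -/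

/-- An integrand `a / u` is dominated by a multiple of `1 / (1 + u²)` as soon as `a` is `O(u)` near
`0` and `O(1/u)` near infinity. -/
theorem abs_div_le_inv_one_add_sq {a C u : ℝ} (hu : 0 < u)
    (h0 : u ≤ 1 → |a| ≤ C * u) (h1 : 1 ≤ u → |a| ≤ C / u) :
    |a / u| ≤ 2 * C * (1 + u ^ 2)⁻¹ := by
  rw [abs_div, abs_of_pos hu, div_le_iff₀ hu, ← div_eq_mul_inv, div_mul_eq_mul_div,
    le_div_iff₀ (by positivity)]
  rcases le_total u 1 with h | h
  · have := h0 h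
    have hC : 0 ≤ C := nonneg_of_mul_nonneg_left ((abs_nonneg a).trans this) hu
    calc |a| * (1 + u ^ 2) ≤ (C * u) * 2 := by gcongr; nlinarith
      _ = _ := by ring
  · have := h1 h
    have hC : 0 ≤ C := by
      have := (abs_nonneg a).trans this
      rwa [le_div_iff₀ hu, zero_mul] at this
    calc |a| * (1 + u ^ 2) ≤ (C / u) * (2 * u ^ 2) := by gcongr; nlinarith
      _ = _ := by field_simp

theorem exp_neg_le_inv {u : ℝ} (hu : 0 < u) : Real.exp (-u) ≤ u⁻¹ := by
  rw [Real.exp_neg]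
  exact inv_anti₀ hu (by linarith [Real.add_one_le_exp u])

theorem integrableOn_exp_neg_sub_exp_neg_mul_div {w : ℝ} (hw : 0 < w) :
    IntegrableOn (fun u : ℝ => (Real.exp (-u) - Real.exp (-(u * w))) / u) (Ioi 0) := by
  refine Integrable.mono' (g := fun u : ℝ => 2 * (1 + w + w⁻¹) * (1 + u ^ 2)⁻¹)
    ((integrable_inv_one_add_sq.const_mul _).integrableOn) ?_ ?_
  · exact (by fun_prop : Measurable _).aestronglyMeasurable
  · filter_upwards [ae_restrict_mem measurableSet_Ioi] with u (hu : 0 < u)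
    have e1 : Real.exp (-u) ≤ 1 := Real.exp_le_one_iff.2 (by linarith)
    have e2 : Real.exp (-(u * w)) ≤ 1 := Real.exp_le_one_iff.2 (by nlinarith)
    have e3 := Real.add_one_le_exp (-u)
    have e4 := Real.add_one_le_exp (-(u * w))
    have e5 := Real.exp_pos (-u)
    have e6 := Real.exp_pos (-(u * w))
    refine abs_div_le_inv_one_add_sq hu (fun _ => ?_) (fun _ => ?_)
    · have : 0 < w⁻¹ * u := by positivity
      have : 0 < w * u := by positivity
      rw [abs_le]; constructor <;> nlinarith
    · have e7 := exp_neg_le_inv hu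
      have e8 := exp_neg_le_inv (mul_pos hu hw)
      rw [mul_inv] at e8
      have : 0 < w⁻¹ * u⁻¹ := by positivity
      have : 0 < w * u⁻¹ := by positivity
      have : 0 < u⁻¹ := by positivity
      rw [abs_le, div_eq_mul_inv]; constructor <;> nlinarith

theorem integral_exp_neg_sub_exp_neg_mul_div {w : ℝ} (hw : 0 < w) :
    ∫ u in Ioi (0 : ℝ), (Real.exp (-u) - Real.exp (-(u * w))) / u = Real.log w := by
  have key := Frullani.integral_Ioi_eq (f := fun x : ℝ => Real.exp (-x)) (a := 1) (b := w)
    (L := 1) (R := 0)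
    ((by fun_prop : Continuous fun x : ℝ => Real.exp (-x)).locallyIntegrable.locallyIntegrableOn _)
    one_pos hw
    (by
      have : Tendsto (fun x : ℝ => Real.exp (-x)) (𝓝 0) (𝓝 (Real.exp (-0))) :=
        (by fun_prop : Continuous fun x : ℝ => Real.exp (-x)).tendsto 0
      simpa using this.mono_left nhdsWithin_le_nhds)
    (Real.tendsto_exp_atBot.comp tendsto_neg_atTop_atBot)
    (by
      refine (integrableOn_exp_neg_sub_exp_neg_mul_div hw).congr_fun (fun u _ => ?_)
        measurableSet_Ioi
      simp [div_eq_inv_mul, mul_comm u w])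
  simpa [div_eq_inv_mul, mul_comm w] using key

theorem integrableOn_exp_neg_sub_inv_div :
    IntegrableOn (fun u : ℝ => (Real.exp (-u) - 1 / (1 + u)) / u) (Ioi 0) := by
  refine Integrable.mono' (g := fun u : ℝ => 2 * 1 * (1 + u ^ 2)⁻¹)
    ((integrable_inv_one_add_sq.const_mul _).integrableOn) ?_ ?_
  · exact (by fun_prop : Measurable _).aestronglyMeasurable
  · filter_upwards [ae_restrict_mem measurableSet_Ioi] with u (hu : 0 < u)
    have e1 : Real.exp (-u) ≤ 1 := Real.exp_le_one_iff.2 (by linarith)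
    have e3 := Real.add_one_le_exp (-u)
    have e5 := Real.exp_pos (-u)
    have e2 : 1 / (1 + u) ≤ 1 := by rw [div_le_one (by linarith)]; linarith
    have e4 : 1 - u ≤ 1 / (1 + u) := by rw [le_div_iff₀ (by linarith)]; nlinarith
    refine abs_div_le_inv_one_add_sq hu (fun _ => ?_) (fun _ => ?_)
    · rw [abs_le]; constructor <;> linarith
    · have e7 := exp_neg_le_inv hu
      have e8 : 1 / (1 + u) ≤ 1 / u := one_div_le_one_div_of_le hu (by linarith)
      have e9 : 0 < 1 / (1 + u) := by positivity
      rw [← one_div] at e7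
      rw [abs_le]; constructor <;> linarith

/-- The value is `Γ'(1)`, by differentiation of the Gamma integral. -/
theorem integrableOn_exp_neg_mul_log :
    IntegrableOn (fun u : ℝ => Real.exp (-u) * Real.log u) (Ioi 0) ∧
      ∫ u in Ioi (0 : ℝ), Real.exp (-u) * Real.log u = -Real.eulerMascheroniConstant := by
  have hpow : ∀ t : ℝ, t ∈ Ioi (0 : ℝ) →
      (t : ℂ) ^ ((1 : ℂ) - 1) * (Real.log t * Real.exp (-t)) =
        ((Real.exp (-t) * Real.log t : ℝ) : ℂ) := by
    intro t _
    rw [sub_self, Complex.cpow_zero, one_mul, mul_comm]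
    push_cast
    rfl
  constructor
  · have hconv := (mellin_hasDerivAt_of_isBigO_rpow (E := ℂ) (a := 2) (b := 0) (s := 1)
      (f := fun x => ((Real.exp (-x) : ℝ) : ℂ)) ?_ ?_ (by norm_num) ?_ (by norm_num)).1
    · have hre := Integrable.re hconv
      refine IntegrableOn.congr_fun (f := _) hre (fun t ht => ?_) measurableSet_Ioi
      have := hpow t ht
      simp only [smul_eq_mul, Complex.real_smul]
      rw [this]
      rfl
    · exact (by fun_prop : Continuous fun x : ℝ =>
        ((Real.exp (-x) : ℝ) : ℂ)).continuousOn.locallyIntegrableOn measurableSet_Ioi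
    · rw [← Asymptotics.isBigO_norm_left]
      simp_rw [Complex.norm_real, Asymptotics.isBigO_norm_left]
      simpa only [neg_one_mul] using (isLittleO_exp_neg_mul_rpow_atTop zero_lt_one _).isBigO
    · simp_rw [neg_zero, Real.rpow_zero]
      refine Asymptotics.isBigO_const_of_tendsto (y := (1 : ℂ)) ?_ one_ne_zero
      have : Tendsto (fun x : ℝ => ((Real.exp (-x) : ℝ) : ℂ)) (𝓝 0)
          (𝓝 ((Real.exp (-0) : ℝ) : ℂ)) :=
        (by fun_prop : Continuous fun x : ℝ => ((Real.exp (-x) : ℝ) : ℂ)).tendsto 0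
      simpa using this.mono_left nhdsWithin_le_nhds
  · have h1 := Complex.hasDerivAt_GammaIntegral (s := 1) (by norm_num)
    have h2 : Complex.GammaIntegral =ᶠ[𝓝 1] Complex.Gamma := by
      filter_upwards [(isOpen_lt continuous_const Complex.continuous_re).mem_nhds
        (show (0 : ℝ) < (1 : ℂ).re by norm_num)] with s hs
      exact (Complex.Gamma_eq_integral hs).symm
    have h3 := (h1.congr_of_eventuallyEq h2.symm).unique Complex.hasDerivAt_Gamma_one
    rw [setIntegral_congr_fun measurableSet_Ioi hpow, integral_complex_ofReal] at h3
    exact_mod_cast h3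

/-- A primitive of the difference of this integrand and `exp (-u) * log u` vanishes at both ends, so
that the integral equals `Γ'(1)`. -/
theorem integral_exp_neg_sub_inv_div :
    ∫ u in Ioi (0 : ℝ), (Real.exp (-u) - 1 / (1 + u)) / u = -Real.eulerMascheroniConstant := by
  obtain ⟨hi, hv⟩ := integrableOn_exp_neg_mul_log
  have key := integral_Ioi_of_hasDerivAt_of_tendsto (a := 0) (m := 0)
    (f := fun u : ℝ => (Real.exp (-u) - 1) * Real.log u + Real.log (1 + u))
    (f' := fun u : ℝ => (Real.exp (-u) - 1 / (1 + u)) / u - Real.exp (-u) * Real.log u)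
    ?_ ?_ (integrableOn_exp_neg_sub_inv_div.sub hi) ?_
  · rw [integral_sub integrableOn_exp_neg_sub_inv_div hi, hv] at key
    simp only [Real.log_zero, mul_zero, add_zero, Real.log_one, zero_sub, neg_zero] at key
    linarith
  · refine ContinuousWithinAt.add ?_ (ContinuousAt.continuousWithinAt ?_)
    · rw [ContinuousWithinAt]
      simp only [Real.log_zero, mul_zero]
      have h0 : Tendsto (fun u : ℝ => |u * Real.log u|) (𝓝[Ici 0] 0) (𝓝 0) := by
        have := (Real.continuous_mul_log.abs.tendsto 0).mono_left
          (nhdsWithin_le_nhds (s := Ici (0 : ℝ)))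
        simpa using this
      refine squeeze_zero_norm' ?_ h0
      filter_upwards [self_mem_nhdsWithin] with u (hu : 0 ≤ u)
      rw [Real.norm_eq_abs, abs_mul, abs_mul]
      refine mul_le_mul_of_nonneg_right ?_ (abs_nonneg _)
      rw [abs_of_nonneg hu, abs_le]
      constructor <;> linarith [Real.add_one_le_exp (-u), Real.exp_le_one_iff.2 (neg_nonpos.2 hu)]
    · exact ContinuousAt.log (by fun_prop) (by norm_num)
  · intro u (hu : 0 < u)
    have h1 : HasDerivAt (fun u : ℝ => Real.exp (-u) - 1) (-Real.exp (-u)) u := by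
      simpa using ((hasDerivAt_neg u).exp.sub_const 1)
    have h2 : HasDerivAt (fun u : ℝ => Real.log (1 + u)) (1 / (1 + u)) u :=
      ((hasDerivAt_id u).const_add 1).log (by simp; linarith)
    refine ((h1.mul (Real.hasDerivAt_log hu.ne')).add h2).congr_deriv ?_
    have : 1 + u ≠ 0 := by positivity
    field_simp
    ring
  · have h1 : Tendsto (fun u : ℝ => Real.exp (-u) * Real.log u) atTop (𝓝 0) := by
      refine squeeze_zero' (g := fun u : ℝ => u ^ 1 * Real.exp (-u)) ?_ ?_
        (Real.tendsto_pow_mul_exp_neg_atTop_nhds_zero 1)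
      · filter_upwards [eventually_ge_atTop 1] with u hu
        exact mul_nonneg (Real.exp_pos _).le (Real.log_nonneg hu)
      · filter_upwards [eventually_gt_atTop 0] with u hu
        rw [pow_one, mul_comm u]
        gcongr
        exact Real.log_le_self hu.le
    have h2 : Tendsto (fun u : ℝ => Real.log (1 + u⁻¹)) atTop (𝓝 0) := by
      have : Tendsto (fun u : ℝ => 1 + u⁻¹) atTop (𝓝 (1 + 0)) :=
        tendsto_inv_atTop_zero.const_add 1
      simpa using (this.log (by norm_num))
    have := h1.add h2
    rw [add_zero] at this
    refine this.congr' ?_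
    filter_upwards [eventually_gt_atTop 0] with u hu
    have : 1 + u⁻¹ = (1 + u) / u := by field_simp; ring
    rw [this, Real.log_div (by positivity) hu.ne']
    ring

theorem integrableOn_exp_neg_mul_div {w U : ℝ} (hw : 0 < w) (hU : 0 < U) :
    IntegrableOn (fun u : ℝ => Real.exp (-(u * w)) / u) (Ioi U) := by
  have h := (integrableOn_exp_mul_Ioi (neg_lt_zero.2 hw) U).div_const U
  refine Integrable.mono' h (by fun_prop : Measurable _).aestronglyMeasurable ?_
  filter_upwards [ae_restrict_mem measurableSet_Ioi] with u (hu : U < u)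
  have hu0 : 0 < u := hU.trans hu
  rw [Real.norm_eq_abs, abs_of_pos (by positivity), neg_mul, mul_comm w]
  gcongr

/-- The tail of the exponential integral: past `V` the exponential decay is used, and between `U`
and `V` only the logarithmic size of `∫ du / u`. -/
theorem integral_exp_neg_mul_div_le {w U V : ℝ} (hw : 0 < w) (hU : 0 < U) (hUV : U ≤ V) :
    ∫ u in Ioi U, Real.exp (-(u * w)) / u ≤
      Real.exp (-(U * w)) * (Real.log (V / U) + 1 / (V * w)) := by
  have hV : 0 < V := hU.trans_le hUV
  have hint := integrableOn_exp_neg_mul_div hw hU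
  rw [← Ioc_union_Ioi_eq_Ioi hUV, setIntegral_union (Ioc_disjoint_Ioi le_rfl) measurableSet_Ioi
    (hint.mono_set Ioc_subset_Ioi_self) (integrableOn_exp_neg_mul_div hw hV), mul_add]
  gcongr ?_ + ?_
  · have hii : IntervalIntegrable (fun u : ℝ => Real.exp (-(U * w)) * (1 / u)) volume U V :=
      (intervalIntegral.intervalIntegrable_one_div
        (fun x hx => by rw [uIcc_of_le hUV] at hx; exact (hU.trans_le hx.1).ne')
        continuousOn_id).const_mul _
    calc ∫ u in Ioc U V, Real.exp (-(u * w)) / u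
        ≤ ∫ u in Ioc U V, Real.exp (-(U * w)) * (1 / u) := by
          refine setIntegral_mono_on (hint.mono_set Ioc_subset_Ioi_self)
            ((intervalIntegrable_iff_integrableOn_Ioc_of_le hUV).1 hii) measurableSet_Ioc ?_
          intro u hu
          have : 0 < u := hU.trans hu.1
          rw [mul_one_div]
          have := hu.1.le
          gcongr
      _ = Real.exp (-(U * w)) * Real.log (V / U) := by
          rw [← intervalIntegral.integral_of_le hUV, intervalIntegral.integral_const_mul,
            integral_one_div_of_pos hU hV]
  · have h := (integrableOn_exp_mul_Ioi (neg_lt_zero.2 hw) V).div_const V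
    calc ∫ u in Ioi V, Real.exp (-(u * w)) / u
        ≤ ∫ u in Ioi V, Real.exp (-w * u) / V := by
          refine setIntegral_mono_on (integrableOn_exp_neg_mul_div hw hV) h measurableSet_Ioi ?_
          intro u (hu : V < u)
          rw [neg_mul, mul_comm w]
          gcongr
      _ = Real.exp (-(V * w)) * (1 / (V * w)) := by
          rw [integral_div, integral_exp_mul_Ioi (neg_lt_zero.2 hw)]
          rw [neg_mul, mul_comm w V]
          field_simp
      _ ≤ Real.exp (-(U * w)) * (1 / (V * w)) := by gcongr

/-! ### Comparing products of cosines with Gaussians -/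

/-- Products of numbers in `[-1, 1]` are Lipschitz in each factor. -/
theorem abs_prod_sub_prod_le {ι : Type*} (s : Finset ι) (a b : ι → ℝ)
    (ha : ∀ i ∈ s, |a i| ≤ 1) (hb : ∀ i ∈ s, |b i| ≤ 1) :
    |∏ i ∈ s, a i - ∏ i ∈ s, b i| ≤ ∑ i ∈ s, |a i - b i| := by
  classical
  induction s using Finset.induction_on with
  | empty => simp
  | insert j s hj ih =>
    rw [Finset.prod_insert hj, Finset.prod_insert hj, Finset.sum_insert hj]
    have h1 : |∏ i ∈ s, a i| ≤ 1 := by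
      rw [Finset.abs_prod]
      exact Finset.prod_le_one (fun _ _ => abs_nonneg _)
        fun i hi => ha i (Finset.mem_insert_of_mem hi)
    have h2 := ih (fun i hi => ha i (Finset.mem_insert_of_mem hi))
      (fun i hi => hb i (Finset.mem_insert_of_mem hi))
    have h3 := hb j (Finset.mem_insert_self _ _)
    calc |a j * ∏ i ∈ s, a i - b j * ∏ i ∈ s, b i|
        = |(a j - b j) * ∏ i ∈ s, a i + b j * (∏ i ∈ s, a i - ∏ i ∈ s, b i)| := by
          congr 1; ring
      _ ≤ |a j - b j| * |∏ i ∈ s, a i| + |b j| * |∏ i ∈ s, a i - ∏ i ∈ s, b i| := by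
          rw [← abs_mul, ← abs_mul]; exact abs_add_le _ _
      _ ≤ |a j - b j| * 1 + 1 * ∑ i ∈ s, |a i - b i| := by gcongr
      _ = _ := by ring

theorem abs_cos_sub_exp_le {x : ℝ} (hx : |x| ≤ 1) :
    |Real.cos x - Real.exp (-(x ^ 2 / 2))| ≤ x ^ 4 := by
  have h1 := abs_le.1 (Real.cos_bound hx)
  have h2 := Real.add_one_le_exp (-(x ^ 2 / 2))
  have h3 : Real.exp (-(x ^ 2 / 2)) ≤ 1 - x ^ 2 / 2 + (x ^ 2 / 2) ^ 2 / 2 := by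
    have h5 := Real.quadratic_le_exp_of_nonneg (x := x ^ 2 / 2) (by positivity)
    rw [Real.exp_neg, inv_le_iff_one_le_mul₀ (Real.exp_pos _)]
    have h6 : 0 < 1 - x ^ 2 / 2 + (x ^ 2 / 2) ^ 2 / 2 := by nlinarith [sq_nonneg (x ^ 2 / 2 - 1)]
    refine le_trans ?_ (mul_le_mul_of_nonneg_left h5 h6.le)
    nlinarith [sq_nonneg ((x ^ 2 / 2) ^ 2)]
  have h4 : |x| ^ 4 = x ^ 4 := by rw [← abs_pow, abs_of_nonneg (by positivity)]
  rw [h4] at h1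
  have h5 : 0 ≤ x ^ 4 := by positivity
  rw [abs_le]
  constructor <;> nlinarith

theorem abs_cos_le_exp_sin_sq (x : ℝ) : |Real.cos x| ≤ Real.exp (-(Real.sin x ^ 2 / 2)) := by
  refine abs_le_of_sq_le_sq ?_ (Real.exp_pos _).le
  rw [← Real.exp_nat_mul, Real.cos_sq']
  have := Real.add_one_le_exp (-(Real.sin x ^ 2))
  calc 1 - Real.sin x ^ 2 ≤ Real.exp (-(Real.sin x ^ 2)) := by linarith
    _ = _ := by congr 1; push_cast; ring

/-- Jordan's inequality, squared. -/
theorem sq_le_sin_sq {x : ℝ} (hx : |x| ≤ Real.pi / 2) :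
    4 / Real.pi ^ 2 * x ^ 2 ≤ Real.sin x ^ 2 := by
  have h := Real.mul_abs_le_abs_sin hx
  have h2 := pow_le_pow_left₀ (by positivity) h 2
  rw [sq_abs] at h2
  calc _ = (2 / Real.pi * |x|) ^ 2 := by rw [mul_pow, sq_abs]; ring
    _ ≤ _ := h2

/-! ### Cosine products along the roots of unity -/

/-- The real part of `v` times the root of unity `exp (2πi k / N)`. -/
noncomputable def phase {N : ℕ} [NeZero N] (v : ℂ) (k : ZMod N) : ℝ :=
  (v * ZMod.stdAddChar k).re

section phase

variable {N : ℕ} [NeZero N]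

theorem norm_stdAddChar (k : ZMod N) : ‖(ZMod.stdAddChar k : ℂ)‖ = 1 := by
  rw [ZMod.stdAddChar_apply, Circle.norm_coe]

theorem sum_stdAddChar_mul {b : ZMod N} (hb : b ≠ 0) :
    ∑ k : ZMod N, (ZMod.stdAddChar (b * k) : ℂ) = 0 := by
  have := AddChar.sum_mulShift b (ZMod.isPrimitive_stdAddChar N)
  rw [if_neg hb] at this
  simpa [mul_comm] using this

theorem abs_phase_le (v : ℂ) (k : ZMod N) : |phase v k| ≤ ‖v‖ := by
  refine (Complex.abs_re_le_norm _).trans ?_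
  rw [norm_mul, norm_stdAddChar, mul_one]

theorem sum_phase_sq (hN : 3 ≤ N) (v : ℂ) :
    ∑ k : ZMod N, phase v k ^ 2 = N * ‖v‖ ^ 2 / 2 := by
  have h2 : (2 : ZMod N) ≠ 0 := by
    have : ((2 : ℕ) : ZMod N) ≠ 0 := by
      rw [Ne, ZMod.natCast_eq_zero_iff]
      exact fun h => absurd (Nat.le_of_dvd two_pos h) (by omega)
    simpa using this
  have h (k : ZMod N) :
      phase v k ^ 2 = ‖v‖ ^ 2 / 2 + (v ^ 2 * ZMod.stdAddChar (2 * k)).re / 2 := by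
    have e1 : (ZMod.stdAddChar (2 * k) : ℂ) = ZMod.stdAddChar k ^ 2 := by
      rw [two_mul, AddChar.map_add_eq_mul, sq]
    have e2 : ‖v‖ ^ 2 = Complex.normSq (v * ZMod.stdAddChar k) := by
      rw [Complex.normSq_eq_norm_sq, norm_mul, norm_stdAddChar, mul_one]
    rw [e1, ← mul_pow, e2, phase]
    generalize v * ZMod.stdAddChar k = z
    rw [Complex.normSq_apply, pow_two z, Complex.mul_re]
    ring
  simp_rw [h, Finset.sum_add_distrib, ← Finset.sum_div, ← Complex.re_sum, ← Finset.mul_sum,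
    sum_stdAddChar_mul h2]
  simp

theorem le_sum_sin_sq_phase (hN : 3 ≤ N) {v : ℂ} (hv : ‖v‖ ≤ Real.pi / 2) :
    2 / Real.pi ^ 2 * (N * ‖v‖ ^ 2) ≤ ∑ k : ZMod N, Real.sin (phase v k) ^ 2 := by
  calc _ = 4 / Real.pi ^ 2 * ∑ k : ZMod N, phase v k ^ 2 := by rw [sum_phase_sq hN]; ring
    _ = ∑ k : ZMod N, 4 / Real.pi ^ 2 * phase v k ^ 2 := Finset.mul_sum _ _ _
    _ ≤ _ := Finset.sum_le_sum fun k _ => sq_le_sin_sq ((abs_phase_le v k).trans hv)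

/-- Differencing: `phase (v * (ζ ^ j - 1))` is the difference of two translates of `phase v`, and
`sin² (a - b) ≤ 2 (sin² a + sin² b)`. -/
theorem sum_sin_sq_phase_sub_le (v : ℂ) (j : ZMod N) :
    ∑ k : ZMod N, Real.sin (phase (v * (ZMod.stdAddChar j - 1)) k) ^ 2 ≤
      4 * ∑ k : ZMod N, Real.sin (phase v k) ^ 2 := by
  have h (k : ZMod N) : phase (v * (ZMod.stdAddChar j - 1)) k = phase v (j + k) - phase v k := by
    rw [phase, phase, phase, AddChar.map_add_eq_mul, ← Complex.sub_re]
    congr 1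
    ring
  have hsin (a b : ℝ) :
      Real.sin (a - b) ^ 2 ≤ 2 * (Real.sin a ^ 2 + Real.sin b ^ 2) := by
    rw [Real.sin_sub]
    have ha := Real.sin_sq_add_cos_sq a
    have hb := Real.sin_sq_add_cos_sq b
    have h1 : (Real.sin a * Real.cos b) ^ 2 ≤ Real.sin a ^ 2 := by
      rw [mul_pow]; exact mul_le_of_le_one_right (sq_nonneg _) (Real.cos_sq_le_one b)
    have h2 : (Real.cos a * Real.sin b) ^ 2 ≤ Real.sin b ^ 2 := by
      rw [mul_pow]; exact mul_le_of_le_one_left (sq_nonneg _) (Real.cos_sq_le_one a)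
    nlinarith [sq_nonneg (Real.sin a * Real.cos b + Real.cos a * Real.sin b)]
  have hshift : ∑ k : ZMod N, Real.sin (phase v (j + k)) ^ 2 =
      ∑ k : ZMod N, Real.sin (phase v k) ^ 2 :=
    Fintype.sum_equiv (Equiv.addLeft j) _ _ fun _ => rfl
  calc _ ≤ ∑ k : ZMod N,
        2 * (Real.sin (phase v (j + k)) ^ 2 + Real.sin (phase v k) ^ 2) :=
        Finset.sum_le_sum fun k _ => by rw [h]; exact hsin _ _
    _ = _ := by rw [← Finset.mul_sum, Finset.sum_add_distrib, hshift]; ring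

/-- A root of unity at distance comparable to `1 / r` from `1`. -/
theorem exists_norm_stdAddChar_sub_one {r : ℝ} (h1 : 1 ≤ r) (h2 : r ≤ N / 4) :
    ∃ j : ZMod N, 1 / 2 ≤ r * ‖(ZMod.stdAddChar j : ℂ) - 1‖ ∧
      r * ‖(ZMod.stdAddChar j : ℂ) - 1‖ ≤ Real.pi / 2 := by
  have hN : (0 : ℝ) < N := by exact_mod_cast NeZero.pos N
  have hr : 0 < r := by linarith
  have hpi := Real.pi_pos
  -- `‖ζ ^ m - 1‖ = 2 sin (π m / N)`, and this `m` makes `π m / N` lie within a factor `2` of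
  -- `π / (4 r)`.
  set m : ℕ := ⌊(N : ℝ) / (4 * r)⌋₊ with hm
  have hy : 1 ≤ (N : ℝ) / (4 * r) := by rw [le_div_iff₀ (by positivity)]; linarith
  have hm1 : (1 : ℝ) ≤ m := by exact_mod_cast (Nat.one_le_floor_iff _).2 hy
  have hm2 : (m : ℝ) ≤ N / (4 * r) := Nat.floor_le (by linarith)
  have hm3 : (N : ℝ) / (4 * r) ≤ 2 * m := by
    have := Nat.lt_floor_add_one ((N : ℝ) / (4 * r))
    rw [← hm] at this
    linarith
  rw [le_div_iff₀ (by positivity)] at hm2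
  rw [div_le_iff₀ (by positivity)] at hm3
  set t : ℝ := Real.pi * m / N with ht
  have ht0 : 0 ≤ t := by positivity
  have ht2 : r * t ≤ Real.pi / 4 := by
    rw [ht, mul_div_assoc', div_le_iff₀ hN]
    nlinarith
  have ht4 : t ≤ Real.pi / 2 := by nlinarith
  have ht1 : 1 / 4 ≤ r * (2 / Real.pi * t) := by
    have : r * (2 / Real.pi * t) = 2 * r * m / N := by rw [ht]; field_simp
    rw [this, le_div_iff₀ hN]
    linarith
  have hnorm : ‖(ZMod.stdAddChar ((m : ℤ) : ZMod N) : ℂ) - 1‖ = 2 * Real.sin t := by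
    have e : (2 * Real.pi * Complex.I * (m : ℤ) / N : ℂ) =
        Complex.I * ((2 * t : ℝ) : ℂ) := by rw [ht]; push_cast; ring
    rw [ZMod.stdAddChar_coe, e, Complex.norm_exp_I_mul_ofReal_sub_one,
      mul_div_cancel_left₀ _ two_ne_zero, Real.norm_eq_abs, abs_of_nonneg]
    exact mul_nonneg two_pos.le (Real.sin_nonneg_of_nonneg_of_le_pi ht0 (by linarith))
  refine ⟨((m : ℤ) : ZMod N), ?_, ?_⟩ <;> rw [hnorm]
  · nlinarith [Real.mul_le_sin ht0 ht4]
  · nlinarith [Real.sin_le ht0]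

theorem abs_prod_cos_phase_le (v : ℂ) :
    |∏ k : ZMod N, Real.cos (phase v k)| ≤
      Real.exp (-((∑ k : ZMod N, Real.sin (phase v k) ^ 2) / 2)) := by
  rw [Finset.abs_prod, Finset.sum_div, ← Finset.sum_neg_distrib, Real.exp_sum]
  exact Finset.prod_le_prod (fun _ _ => abs_nonneg _) fun k _ => abs_cos_le_exp_sin_sq _

theorem abs_prod_cos_phase_le_one (v : ℂ) : |∏ k : ZMod N, Real.cos (phase v k)| ≤ 1 := by
  rw [Finset.abs_prod]
  exact Finset.prod_le_one (fun _ _ => abs_nonneg _) fun k _ => Real.abs_cos_le_one _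

theorem abs_prod_cos_phase_le_of_norm_le (hN : 3 ≤ N) {v : ℂ} (hv : ‖v‖ ≤ Real.pi / 2) :
    |∏ k : ZMod N, Real.cos (phase v k)| ≤ Real.exp (-(N * ‖v‖ ^ 2 / Real.pi ^ 2)) := by
  refine (abs_prod_cos_phase_le v).trans (Real.exp_le_exp.2 (neg_le_neg ?_))
  have := le_sum_sin_sq_phase hN hv
  calc _ = 2 / Real.pi ^ 2 * (N * ‖v‖ ^ 2) / 2 := by ring
    _ ≤ _ := by linarith

/-- In the intermediate range, differencing reduces to a phase of size of order `1`. -/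
theorem abs_prod_cos_phase_le_of_le_norm (hN : 3 ≤ N) {v : ℂ} (h1 : 1 ≤ ‖v‖)
    (h2 : ‖v‖ ≤ N / 4) :
    |∏ k : ZMod N, Real.cos (phase v k)| ≤ Real.exp (-(N / 160)) := by
  obtain ⟨j, hj1, hj2⟩ := exists_norm_stdAddChar_sub_one h1 h2
  rw [← norm_mul] at hj1 hj2
  refine (abs_prod_cos_phase_le v).trans (Real.exp_le_exp.2 (neg_le_neg ?_))
  have h3 := le_sum_sin_sq_phase hN hj2
  have h4 := sum_sin_sq_phase_sub_le v j
  have hpi : Real.pi ^ 2 ≤ 10 := by nlinarith [Real.pi_lt_d2, Real.pi_pos]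
  have h5 : (N : ℝ) / 20 ≤ 2 / Real.pi ^ 2 * (N * ‖v * (ZMod.stdAddChar j - 1)‖ ^ 2) := by
    rw [div_mul_eq_mul_div, le_div_iff₀ (by positivity)]
    have : (1 / 4 : ℝ) ≤ ‖v * (ZMod.stdAddChar j - 1)‖ ^ 2 := by nlinarith
    have hN0 : (0 : ℝ) ≤ N := Nat.cast_nonneg N
    nlinarith
  linarith

end phase

/-! ### Random signed sums of roots of unity and their Laplace transform -/

/-- The sum `∑ ε_k ζ ^ k` over the `N`th roots of unity with signs `ε_k = ±1`. -/
noncomputable def signSum {N : ℕ} [NeZero N] (ε : ZMod N → ℤˣ) : ℂ :=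
  ∑ k, ((ε k : ℤ) : ℂ) * ZMod.stdAddChar k

/-- The squared modulus of `signSum`, normalized to have mean `1` over all choices of signs. -/
noncomputable def energy {N : ℕ} [NeZero N] (ε : ZMod N → ℤˣ) : ℝ := ‖signSum ε‖ ^ 2 / N

/-- The Laplace transform of `energy` for independent uniform signs. -/
noncomputable def laplace (N : ℕ) [NeZero N] (u : ℝ) : ℝ :=
  (∑ ε : ZMod N → ℤˣ, Real.exp (-(u * energy ε))) / 2 ^ N

theorem integral_exp_neg_mul_norm_sq {b : ℝ} (hb : 0 < b) :
    ∫ g : ℂ, Real.exp (-b * ‖g‖ ^ 2) = Real.pi / b := by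
  rw [GaussianFourier.integral_rexp_neg_mul_sq_norm hb, Complex.finrank_real_complex]
  simp

theorem integrable_exp_neg_mul_norm_sq {b : ℝ} (hb : 0 < b) :
    Integrable fun g : ℂ => Real.exp (-b * ‖g‖ ^ 2) := by
  by_contra h
  have := integral_undef h
  rw [integral_exp_neg_mul_norm_sq hb] at this
  exact absurd this (by positivity)

theorem integrable_exp_neg_mul_norm_sq_mul {b : ℝ} (hb : 0 < b) {f : ℂ → ℝ} (hf : Continuous f)
    (h : ∀ g, |f g| ≤ 1) : Integrable fun g : ℂ => Real.exp (-b * ‖g‖ ^ 2) * f g := by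
  refine (integrable_exp_neg_mul_norm_sq hb).mono' (by fun_prop) (ae_of_all _ fun g => ?_)
  rw [Real.norm_eq_abs, abs_mul, abs_of_pos (Real.exp_pos _)]
  exact mul_le_of_le_one_right (Real.exp_pos _).le (h g)

/-- The Gaussian is the Fourier transform of a Gaussian. -/
theorem integral_exp_neg_norm_sq_mul_cos (s : ℝ) (z : ℂ) :
    ∫ g : ℂ, Real.exp (-1 * ‖g‖ ^ 2) * Real.cos (2 * s * inner ℝ z g) =
      Real.pi * Real.exp (-(s ^ 2 * ‖z‖ ^ 2)) := by
  have hint := GaussianFourier.integrable_cexp_neg_mul_sq_norm_add (V := ℂ) (b := 1)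
    (by norm_num) (2 * s * Complex.I) z
  have hval := GaussianFourier.integral_cexp_neg_mul_sq_norm_add (V := ℂ) (b := 1)
    (by norm_num) (2 * s * Complex.I) z
  have hre := congrArg Complex.re hval
  have hswap : ∫ g : ℂ, (Complex.exp (-1 * (‖g‖ : ℂ) ^ 2 +
      2 * s * Complex.I * ((inner ℝ z g : ℝ) : ℂ))).re =
      (∫ g : ℂ, Complex.exp (-1 * (‖g‖ : ℂ) ^ 2 +
      2 * s * Complex.I * ((inner ℝ z g : ℝ) : ℂ))).re := integral_re hint
  rw [← hswap] at hre
  have e1 (g : ℂ) : (Complex.exp (-1 * (‖g‖ : ℂ) ^ 2 +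
      2 * s * Complex.I * ((inner ℝ z g : ℝ) : ℂ))).re =
      Real.exp (-1 * ‖g‖ ^ 2) * Real.cos (2 * s * inner ℝ z g) := by
    have : (-1 * (‖g‖ : ℂ) ^ 2 + 2 * s * Complex.I * ((inner ℝ z g : ℝ) : ℂ)) =
        ((-1 * ‖g‖ ^ 2 : ℝ) : ℂ) + ((2 * s * inner ℝ z g : ℝ) : ℂ) * Complex.I := by
      push_cast; ring
    rw [this, Complex.exp_re]
    simp [-Complex.ofReal_mul, -Complex.ofReal_pow, -Complex.ofReal_neg]
  have e2 : ((Real.pi : ℂ) / 1) ^ (((Module.finrank ℝ ℂ : ℕ) : ℂ) / 2) *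
      Complex.exp ((2 * s * Complex.I) ^ 2 * (‖z‖ : ℂ) ^ 2 / (4 * 1)) =
      ((Real.pi * Real.exp (-(s ^ 2 * ‖z‖ ^ 2)) : ℝ) : ℂ) := by
    rw [Complex.finrank_real_complex]
    have : (2 * s * Complex.I) ^ 2 * (‖z‖ : ℂ) ^ 2 / (4 * 1) =
        ((-(s ^ 2 * ‖z‖ ^ 2) : ℝ) : ℂ) := by
      push_cast
      rw [mul_pow, Complex.I_sq]
      ring
    rw [this]
    simp
  rw [e2, Complex.ofReal_re] at hre
  rw [← hre]
  exact integral_congr_ae (ae_of_all _ fun g => (e1 g).symm)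

/-- Independence of the signs: the characteristic function of a signed sum is a product. -/
theorem sum_cos_signed_sum {ι : Type*} [Fintype ι] [DecidableEq ι] (x : ι → ℝ) :
    ∑ ε : ι → ℤˣ, Real.cos (∑ i, ((ε i : ℤ) : ℝ) * x i) =
      2 ^ Fintype.card ι * ∏ i, Real.cos (x i) := by
  have h : ∑ ε : ι → ℤˣ, Complex.exp (((∑ i, ((ε i : ℤ) : ℝ) * x i : ℝ) : ℂ) * Complex.I) =
      ((2 ^ Fintype.card ι * ∏ i, Real.cos (x i) : ℝ) : ℂ) := by
    have e1 (i : ι) : ∑ δ : ℤˣ, Complex.exp ((((δ : ℤ) : ℝ) * x i : ℝ) * Complex.I) =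
        2 * (Real.cos (x i) : ℂ) := by
      rw [UnitsInt.univ, Finset.sum_pair (by decide)]
      push_cast
      rw [Complex.cos]
      simp
      ring
    calc _ = ∑ ε : ι → ℤˣ, ∏ i, Complex.exp ((((ε i : ℤ) : ℝ) * x i : ℝ) * Complex.I) := by
          refine Finset.sum_congr rfl fun ε _ => ?_
          rw [← Complex.exp_sum, ← Finset.sum_mul, Complex.ofReal_sum]
      _ = ∏ i, ∑ δ : ℤˣ, Complex.exp ((((δ : ℤ) : ℝ) * x i : ℝ) * Complex.I) := by
          rw [Finset.prod_univ_sum, Fintype.piFinset_univ]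
      _ = _ := by
          simp_rw [e1, Finset.prod_mul_distrib]
          simp
  have h2 := congrArg Complex.re h
  rw [Complex.re_sum, Complex.ofReal_re] at h2
  simpa only [Complex.exp_ofReal_mul_I_re] using h2

theorem norm_sqrt_mul_conj (N : ℕ) {u : ℝ} (hu : 0 ≤ u) (g : ℂ) :
    ‖((2 * √(u / N) : ℝ) : ℂ) * (starRingEnd ℂ) g‖ ^ 2 = 4 * u * ‖g‖ ^ 2 / N := by
  rw [norm_mul, Complex.norm_real, RCLike.norm_conj, mul_pow, Real.norm_eq_abs, sq_abs, mul_pow,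
    Real.sq_sqrt (by positivity)]
  ring

section laplace

variable {N : ℕ} [NeZero N]

theorem continuous_prod_cos_phase (c : ℝ) : Continuous fun g : ℂ =>
    ∏ k : ZMod N, Real.cos (phase (c * (starRingEnd ℂ) g) k) := by
  unfold phase
  fun_prop

theorem inner_signSum (s : ℝ) (ε : ZMod N → ℤˣ) (g : ℂ) :
    2 * s * inner ℝ (signSum ε) g =
      ∑ k, ((ε k : ℤ) : ℝ) * phase (((2 * s : ℝ) : ℂ) * (starRingEnd ℂ) g) k := by
  rw [real_inner_comm, Complex.inner, signSum, Finset.sum_mul, Complex.re_sum, Finset.mul_sum]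
  refine Finset.sum_congr rfl fun k _ => ?_
  rw [phase]
  have h1 : ((ε k : ℤ) : ℂ) * ZMod.stdAddChar k * (starRingEnd ℂ) g =
      (((ε k : ℤ) : ℝ) : ℂ) * (ZMod.stdAddChar k * (starRingEnd ℂ) g) := by push_cast; ring
  have h2 : ((2 * s : ℝ) : ℂ) * (starRingEnd ℂ) g * ZMod.stdAddChar k =
      ((2 * s : ℝ) : ℂ) * (ZMod.stdAddChar k * (starRingEnd ℂ) g) := by ring
  rw [h1, h2, Complex.re_ofReal_mul, Complex.re_ofReal_mul]
  ring

/-- The Laplace transform as a Gaussian average of products of cosines. -/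
theorem laplace_eq_integral {u : ℝ} (hu : 0 ≤ u) :
    laplace N u = (∫ g : ℂ, Real.exp (-1 * ‖g‖ ^ 2) *
      ∏ k : ZMod N, Real.cos (phase (((2 * √(u / N) : ℝ) : ℂ) * (starRingEnd ℂ) g) k)) /
        Real.pi := by
  have hs : √(u / N) ^ 2 = u / N := Real.sq_sqrt (by positivity)
  set s := √(u / N)
  have h1 (ε : ZMod N → ℤˣ) : Real.exp (-(u * energy ε)) =
      (∫ g : ℂ, Real.exp (-1 * ‖g‖ ^ 2) * Real.cos (2 * s * inner ℝ (signSum ε) g)) /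
        Real.pi := by
    rw [integral_exp_neg_norm_sq_mul_cos, mul_div_cancel_left₀ _ Real.pi_ne_zero, hs, energy]
    congr 1
    ring
  rw [laplace]
  simp_rw [h1]
  rw [← Finset.sum_div, ← integral_finsetSum, div_div, mul_comm Real.pi, ← div_div]
  · congr 1
    rw [← integral_div]
    refine integral_congr_ae (ae_of_all _ fun g => ?_)
    simp only
    rw [← Finset.mul_sum]
    simp_rw [inner_signSum]
    rw [sum_cos_signed_sum, ZMod.card]
    field_simp
  · intro ε _
    exact integrable_exp_neg_mul_norm_sq_mul one_pos (by fun_prop) fun g => Real.abs_cos_le_one _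

theorem energy_nonneg (ε : ZMod N → ℤˣ) : 0 ≤ energy ε := by unfold energy; positivity

theorem one_sub_laplace_le (hN : 3 ≤ N) {u : ℝ} (hu : 0 ≤ u) : 1 - laplace N u ≤ 4 * u := by
  have hi1 := integrable_exp_neg_mul_norm_sq one_pos
  have hi2 := integrable_exp_neg_mul_norm_sq_mul (b := 1) one_pos
    (continuous_prod_cos_phase (N := N) (2 * √(u / N))) fun g => abs_prod_cos_phase_le_one _
  have h1 : 1 = (∫ g : ℂ, Real.exp (-1 * ‖g‖ ^ 2)) / Real.pi := by
    rw [integral_exp_neg_mul_norm_sq one_pos, div_one, div_self Real.pi_ne_zero]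
  have h2 : 4 * u = (∫ g : ℂ, 2 * u * Real.exp (-(1 / 2) * ‖g‖ ^ 2)) / Real.pi := by
    rw [integral_const_mul, integral_exp_neg_mul_norm_sq (by norm_num)]
    field_simp
    ring
  rw [laplace_eq_integral hu, h2]
  nth_rewrite 1 [h1]
  rw [← sub_div, ← integral_sub hi1 hi2]
  refine div_le_div_of_nonneg_right ?_ Real.pi_pos.le
  refine integral_mono (hi1.sub hi2)
    ((integrable_exp_neg_mul_norm_sq (by norm_num)).const_mul _) fun g => ?_
  set v := ((2 * √(u / N) : ℝ) : ℂ) * (starRingEnd ℂ) g with hv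
  have h3 : 1 - ∏ k : ZMod N, Real.cos (phase v k) ≤ u * ‖g‖ ^ 2 := by
    have := abs_prod_sub_prod_le Finset.univ (fun k : ZMod N => Real.cos (phase v k))
      (fun _ => 1) (fun _ _ => Real.abs_cos_le_one _) (fun _ _ => by simp)
    rw [Finset.prod_const_one, abs_sub_comm] at this
    calc _ ≤ ∑ k : ZMod N, |Real.cos (phase v k) - 1| := (le_abs_self _).trans this
      _ ≤ ∑ k : ZMod N, phase v k ^ 2 / 2 := by
          refine Finset.sum_le_sum fun k _ => ?_
          rw [abs_sub_comm, abs_of_nonneg (by linarith [Real.cos_le_one (phase v k)])]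
          linarith [Real.one_sub_sq_div_two_le_cos (x := phase v k)]
      _ = u * ‖g‖ ^ 2 := by
          have hN0 : (N : ℝ) ≠ 0 := by exact_mod_cast NeZero.ne N
          rw [← Finset.sum_div, sum_phase_sq hN, hv, norm_sqrt_mul_conj N hu]
          field_simp
          ring
  have h4 : ‖g‖ ^ 2 ≤ 2 * Real.exp (1 / 2 * ‖g‖ ^ 2) := by
    linarith [Real.add_one_le_exp (1 / 2 * ‖g‖ ^ 2)]
  calc Real.exp (-1 * ‖g‖ ^ 2) - Real.exp (-1 * ‖g‖ ^ 2) * ∏ k : ZMod N, Real.cos (phase v k)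
      = Real.exp (-1 * ‖g‖ ^ 2) * (1 - ∏ k : ZMod N, Real.cos (phase v k)) := by ring
    _ ≤ Real.exp (-1 * ‖g‖ ^ 2) * (u * (2 * Real.exp (1 / 2 * ‖g‖ ^ 2))) := by
        gcongr
        exact h3.trans (by gcongr)
    _ = 2 * u * (Real.exp (-1 * ‖g‖ ^ 2) * Real.exp (1 / 2 * ‖g‖ ^ 2)) := by ring
    _ = _ := by rw [← Real.exp_add]; congr 2; ring

/-- The three terms come from the three ranges of the phase `v`: small, where the product of cosines
is Gaussian; intermediate, where it is exponentially small; and `‖v‖ > N / 4`, where the Gaussian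
weight is exponentially small because `u ≤ N ^ 2`. -/
theorem laplace_le (hN : 3 ≤ N) {u : ℝ} (hu : 0 < u) (huN : u ≤ N ^ 2) :
    laplace N u ≤ (1 + 4 * u / Real.pi ^ 2)⁻¹ + 3 * Real.exp (-(N / 160)) := by
  have hN0 : (0 : ℝ) < N := by exact_mod_cast NeZero.pos N
  have hb : 0 < 1 + 4 * u / Real.pi ^ 2 := by positivity
  have hi2 := integrable_exp_neg_mul_norm_sq_mul (b := 1) one_pos
    (continuous_prod_cos_phase (N := N) (2 * √(u / N))) fun g => abs_prod_cos_phase_le_one _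
  have hj1 := integrable_exp_neg_mul_norm_sq hb
  have hj2 := (integrable_exp_neg_mul_norm_sq one_pos).mul_const (Real.exp (-(N / 160)))
  have hj3 := (integrable_exp_neg_mul_norm_sq one_half_pos).mul_const (Real.exp (-(N / 160)))
  have hval : (1 + 4 * u / Real.pi ^ 2)⁻¹ + 3 * Real.exp (-(N / 160)) =
      (∫ g : ℂ, (Real.exp (-(1 + 4 * u / Real.pi ^ 2) * ‖g‖ ^ 2) +
        Real.exp (-1 * ‖g‖ ^ 2) * Real.exp (-(N / 160)) +
        Real.exp (-(1 / 2) * ‖g‖ ^ 2) * Real.exp (-(N / 160)))) / Real.pi := by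
    have hj12 : Integrable fun g : ℂ => Real.exp (-(1 + 4 * u / Real.pi ^ 2) * ‖g‖ ^ 2) +
        Real.exp (-1 * ‖g‖ ^ 2) * Real.exp (-(N / 160)) := hj1.add hj2
    rw [integral_add hj12 hj3, integral_add hj1 hj2, integral_mul_const,
      integral_mul_const, integral_exp_neg_mul_norm_sq hb, integral_exp_neg_mul_norm_sq one_pos,
      integral_exp_neg_mul_norm_sq one_half_pos]
    have := Real.pi_ne_zero
    field_simp
    ring
  rw [hval, laplace_eq_integral hu.le]
  refine div_le_div_of_nonneg_right (integral_mono hi2 ((hj1.add hj2).add hj3) fun g => ?_)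
    Real.pi_pos.le
  have hvsq := norm_sqrt_mul_conj N hu.le g
  set v := ((2 * √(u / N) : ℝ) : ℂ) * (starRingEnd ℂ) g with hv
  set P := ∏ k : ZMod N, Real.cos (phase v k) with hP
  have hP1 : P ≤ |P| := le_abs_self _
  have p1 := Real.exp_pos (-(1 + 4 * u / Real.pi ^ 2) * ‖g‖ ^ 2)
  have p2 : 0 < Real.exp (-1 * ‖g‖ ^ 2) * Real.exp (-(N / 160)) := by positivity
  have p3 : 0 < Real.exp (-(1 / 2) * ‖g‖ ^ 2) * Real.exp (-(N / 160)) := by positivity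
  change Real.exp (-1 * ‖g‖ ^ 2) * P ≤ _
  rcases le_or_gt ‖v‖ (Real.pi / 2) with h1 | h1
  · have := mul_le_mul_of_nonneg_left
      (hP1.trans (abs_prod_cos_phase_le_of_norm_le hN h1)) (Real.exp_pos (-1 * ‖g‖ ^ 2)).le
    rw [← Real.exp_add, hvsq] at this
    have e : -1 * ‖g‖ ^ 2 + -(N * (4 * u * ‖g‖ ^ 2 / N) / Real.pi ^ 2) =
        -(1 + 4 * u / Real.pi ^ 2) * ‖g‖ ^ 2 := by
      field_simp
      ring
    rw [e] at this
    linarith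
  · rcases le_or_gt ‖v‖ (N / 4) with h2 | h2
    · have h1' : 1 ≤ ‖v‖ := by linarith [Real.pi_gt_three]
      have := mul_le_mul_of_nonneg_left
        (hP1.trans (abs_prod_cos_phase_le_of_le_norm hN h1' h2)) (Real.exp_pos (-1 * ‖g‖ ^ 2)).le
      linarith
    · have h3 : (N : ℝ) / 64 ≤ ‖g‖ ^ 2 := by
        have h4 : ((N : ℝ) / 4) ^ 2 < ‖v‖ ^ 2 := by gcongr
        rw [hvsq, lt_div_iff₀ hN0] at h4
        have h5 : 4 * u * ‖g‖ ^ 2 ≤ 4 * N ^ 2 * ‖g‖ ^ 2 := by gcongr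
        have h6 : 0 < (N : ℝ) ^ 2 := by positivity
        nlinarith
      have h7 : Real.exp (-1 * ‖g‖ ^ 2) * P ≤ Real.exp (-1 * ‖g‖ ^ 2) :=
        mul_le_of_le_one_right (Real.exp_pos _).le (hP1.trans (abs_prod_cos_phase_le_one v))
      have h8 : Real.exp (-1 * ‖g‖ ^ 2) ≤
          Real.exp (-(1 / 2) * ‖g‖ ^ 2) * Real.exp (-(N / 160)) := by
        rw [← Real.exp_add]
        exact Real.exp_le_exp.2 (by linarith)
      linarith

theorem laplace_le_div (hN : 3 ≤ N) {u : ℝ} (hu : 0 < u) (huN : u ≤ N ^ 2) :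
    laplace N u ≤ 200000 / u := by
  have hN0 : (0 : ℝ) < N := by exact_mod_cast NeZero.pos N
  refine (laplace_le hN hu huN).trans ?_
  have hpi : Real.pi ^ 2 ≤ 10 := by nlinarith [Real.pi_lt_d2, Real.pi_pos]
  have h1 : (1 + 4 * u / Real.pi ^ 2)⁻¹ ≤ 10 / u := by
    rw [inv_le_comm₀ (by positivity) (by positivity), inv_div, div_le_iff₀ (by norm_num)]
    have : 4 * u / 10 ≤ 4 * u / Real.pi ^ 2 := by gcongr
    linarith
  -- `exp x ≥ x ^ 2 / 2` at `x = N / 160`, together with `u ≤ N ^ 2`.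
  have h2 : Real.exp (-(N / 160)) ≤ 51200 / u := by
    have h3 := Real.quadratic_le_exp_of_nonneg (x := (N : ℝ) / 160) (by positivity)
    rw [Real.exp_neg, inv_le_comm₀ (Real.exp_pos _) (by positivity), inv_div]
    have : 0 < (N : ℝ) / 160 := by positivity
    linarith
  calc _ ≤ 10 / u + 3 * (51200 / u) := by gcongr
    _ ≤ 200000 / u := by
      rw [← mul_div_assoc, ← add_div]
      gcongr
      norm_num

end laplace

/-- The central limit theorem for `signSum`, in terms of Laplace transforms: the limiting energy is
exponentially distributed. -/
theorem tendsto_laplace {u : ℝ} (hu : 0 ≤ u) :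
    Tendsto (fun n : ℕ => laplace (n + 1) u) atTop (𝓝 (1 / (1 + u))) := by
  have hlim : 1 / (1 + u) =
      (∫ g : ℂ, Real.exp (-1 * ‖g‖ ^ 2) * Real.exp (-(u * ‖g‖ ^ 2))) / Real.pi := by
    have (g : ℂ) : Real.exp (-1 * ‖g‖ ^ 2) * Real.exp (-(u * ‖g‖ ^ 2)) =
        Real.exp (-(1 + u) * ‖g‖ ^ 2) := by
      rw [← Real.exp_add]; congr 1; ring
    simp_rw [this]
    rw [integral_exp_neg_mul_norm_sq (by linarith)]
    have := Real.pi_ne_zero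
    field_simp
  rw [hlim]
  simp_rw [laplace_eq_integral hu]
  refine Tendsto.div_const ?_ _
  refine tendsto_integral_of_dominated_convergence (fun g : ℂ => Real.exp (-1 * ‖g‖ ^ 2))
    (fun n => (integrable_exp_neg_mul_norm_sq_mul (b := 1) one_pos
      (continuous_prod_cos_phase (N := n + 1) _)
      fun g => abs_prod_cos_phase_le_one _).aestronglyMeasurable)
    (integrable_exp_neg_mul_norm_sq one_pos) (fun n => ae_of_all _ fun g => ?_)
    (ae_of_all _ fun g => ?_)
  · rw [Real.norm_eq_abs, abs_mul, abs_of_pos (Real.exp_pos _)]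
    exact mul_le_of_le_one_right (Real.exp_pos _).le (abs_prod_cos_phase_le_one _)
  · refine Tendsto.const_mul _ ?_
    rw [tendsto_iff_norm_sub_tendsto_zero]
    have hz : Tendsto (fun n : ℕ => 8 * u ^ 2 * ‖g‖ ^ 4 * (1 / ((n : ℝ) + 1))) atTop (𝓝 0) := by
      simpa only [mul_zero] using
        (tendsto_one_div_add_atTop_nhds_zero_nat (𝕜 := ℝ)).const_mul (8 * u ^ 2 * ‖g‖ ^ 4)
    have hsmall : ∀ᶠ n : ℕ in atTop, 4 * u * ‖g‖ ^ 2 * (1 / ((n : ℝ) + 1)) ≤ 1 := by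
      have : Tendsto (fun n : ℕ => 4 * u * ‖g‖ ^ 2 * (1 / ((n : ℝ) + 1))) atTop (𝓝 0) := by
        simpa only [mul_zero] using
          (tendsto_one_div_add_atTop_nhds_zero_nat (𝕜 := ℝ)).const_mul (4 * u * ‖g‖ ^ 2)
      exact this.eventually_le_const one_pos
    refine squeeze_zero' (Eventually.of_forall fun _ => norm_nonneg _) ?_ hz
    filter_upwards [hsmall, eventually_ge_atTop 2] with n hn hn2
    have hvsq := norm_sqrt_mul_conj (n + 1) hu g
    set v := ((2 * √(u / (n + 1 : ℕ)) : ℝ) : ℂ) * (starRingEnd ℂ) g with hv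
    have hn0 : (0 : ℝ) < (n + 1 : ℕ) := by positivity
    have hv1 : ‖v‖ ≤ 1 := by
      rw [← sq_le_one_iff₀ (norm_nonneg v), hvsq]
      refine le_trans (le_of_eq ?_) hn
      push_cast
      ring
    have hsq := sum_phase_sq (N := n + 1) (by omega) v
    have hexp : Real.exp (-(u * ‖g‖ ^ 2)) =
        ∏ k : ZMod (n + 1), Real.exp (-(phase v k ^ 2 / 2)) := by
      rw [← Real.exp_sum, Finset.sum_neg_distrib, ← Finset.sum_div, hsq, hvsq]
      congr 2
      field_simp
      norm_num
    rw [Real.norm_eq_abs, hexp]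
    calc _ ≤ ∑ k : ZMod (n + 1), |Real.cos (phase v k) - Real.exp (-(phase v k ^ 2 / 2))| := by
          refine abs_prod_sub_prod_le _ _ _ (fun _ _ => Real.abs_cos_le_one _) fun k _ => ?_
          rw [abs_of_pos (Real.exp_pos _)]
          exact Real.exp_le_one_iff.2 (by linarith [sq_nonneg (phase v k)])
      _ ≤ ∑ k : ZMod (n + 1), ‖v‖ ^ 2 * phase v k ^ 2 := by
          refine Finset.sum_le_sum fun k _ => ?_
          have hk := abs_phase_le v k
          refine (abs_cos_sub_exp_le (hk.trans hv1)).trans ?_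
          have : phase v k ^ 2 ≤ ‖v‖ ^ 2 := sq_le_sq.2 (by rwa [abs_of_nonneg (norm_nonneg v)])
          calc phase v k ^ 4 = phase v k ^ 2 * phase v k ^ 2 := by ring
            _ ≤ _ := by gcongr
      _ = 8 * u ^ 2 * ‖g‖ ^ 4 * (1 / ((n : ℝ) + 1)) := by
          rw [← Finset.mul_sum, hsq, hvsq]
          push_cast
          field_simp
          ring

/-! ### The mean logarithm of the energy over the nonconstant sign patterns -/

/-- The sign patterns that are not constant. -/
def nonconstSigns (N : ℕ) [NeZero N] : Finset (ZMod N → ℤˣ) := {1, -1}ᶜ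

/-- The Laplace transform of `energy` for a uniformly random nonconstant sign pattern. -/
noncomputable def condLaplace (N : ℕ) [NeZero N] (u : ℝ) : ℝ :=
  (∑ ε ∈ nonconstSigns N, Real.exp (-(u * energy ε))) / (2 ^ N - 2)

/-- The mean of `log energy` for a uniformly random nonconstant sign pattern. -/
noncomputable def meanLogEnergy (N : ℕ) [NeZero N] : ℝ :=
  (∑ ε ∈ nonconstSigns N, Real.log (energy ε)) / (2 ^ N - 2)

theorem two_le_two_pow_sub_two {N : ℕ} (hN : 2 ≤ N) : (2 : ℝ) ^ N ≤ 2 * (2 ^ N - 2) := by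
  have : (2 : ℝ) ^ 2 ≤ 2 ^ N := pow_le_pow_right₀ one_le_two hN
  linarith

theorem two_pow_sub_two_pos {N : ℕ} (hN : 2 ≤ N) : (0 : ℝ) < 2 ^ N - 2 := by
  have : (2 : ℝ) ^ 2 ≤ 2 ^ N := pow_le_pow_right₀ one_le_two hN
  linarith

theorem one_ne_neg_one_signs (N : ℕ) : (1 : ZMod N → ℤˣ) ≠ -1 :=
  fun h => absurd (show (1 : ℤˣ) = -1 from congrFun h 0) (by decide)

section conditioned

variable {N : ℕ} [NeZero N]

theorem card_nonconstSigns (hN : 2 ≤ N) : ((nonconstSigns N).card : ℝ) = 2 ^ N - 2 := by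
  rw [nonconstSigns, Finset.card_compl, Finset.card_pair (one_ne_neg_one_signs N), Fintype.card_fun,
    ZMod.card, Fintype.card_units_int, Nat.cast_sub]
  · push_cast; rfl
  · calc 2 = 2 ^ 1 := rfl
      _ ≤ 2 ^ N := Nat.pow_le_pow_right two_pos (by omega)

/-- The two constant patterns have energy `0` and contribute `1` each. -/
theorem condLaplace_eq (hN : 2 ≤ N) (u : ℝ) :
    condLaplace N u = (2 ^ N * laplace N u - 2) / (2 ^ N - 2) := by
  have : Fact (1 < N) := ⟨hN⟩
  have h1 : signSum (1 : ZMod N → ℤˣ) = 0 := by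
    simpa [signSum] using sum_stdAddChar_mul (N := N) one_ne_zero
  have h2 : signSum (-1 : ZMod N → ℤˣ) = 0 := by
    simpa [signSum] using h1
  have h3 := Finset.sum_compl_add_sum ({1, -1} : Finset (ZMod N → ℤˣ))
    fun ε => Real.exp (-(u * energy ε))
  rw [Finset.sum_pair (one_ne_neg_one_signs N)] at h3
  have h4 : energy (1 : ZMod N → ℤˣ) = 0 := by simp [energy, h1]
  have h5 : energy (-1 : ZMod N → ℤˣ) = 0 := by simp [energy, h2]
  rw [h4, h5, mul_zero, neg_zero, Real.exp_zero] at h3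
  rw [condLaplace, laplace, mul_div_cancel₀ _ (by positivity), nonconstSigns]
  congr 1
  linarith

theorem condLaplace_nonneg (hN : 2 ≤ N) (u : ℝ) : 0 ≤ condLaplace N u := by
  have := two_pow_sub_two_pos hN
  unfold condLaplace
  positivity

theorem condLaplace_le_one (hN : 2 ≤ N) {u : ℝ} (hu : 0 ≤ u) : condLaplace N u ≤ 1 := by
  rw [condLaplace, div_le_one (two_pow_sub_two_pos hN), ← card_nonconstSigns hN]
  calc _ ≤ ∑ ε ∈ nonconstSigns N, (1 : ℝ) := by
        refine Finset.sum_le_sum fun ε _ => Real.exp_le_one_iff.2 ?_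
        have := energy_nonneg ε
        have : 0 ≤ u * energy ε := by positivity
        linarith
    _ = _ := by simp

theorem one_sub_condLaplace_le (hN : 3 ≤ N) {u : ℝ} (hu : 0 ≤ u) :
    1 - condLaplace N u ≤ 8 * u := by
  have hp := two_pow_sub_two_pos (N := N) (by omega)
  have hq := two_le_two_pow_sub_two (N := N) (by omega)
  rw [condLaplace_eq (by omega), one_sub_div hp.ne', div_le_iff₀ hp]
  calc _ = (2 : ℝ) ^ N * (1 - laplace N u) := by ring
    _ ≤ 2 ^ N * (4 * u) := by gcongr; exact one_sub_laplace_le hN hu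
    _ ≤ (2 * (2 ^ N - 2)) * (4 * u) := by gcongr
    _ = _ := by ring

theorem condLaplace_le_div (hN : 3 ≤ N) {u : ℝ} (hu : 0 < u) (huN : u ≤ N ^ 2) :
    condLaplace N u ≤ 400000 / u := by
  have hp := two_pow_sub_two_pos (N := N) (by omega)
  have hq := two_le_two_pow_sub_two (N := N) (by omega)
  rw [condLaplace_eq (by omega), div_le_iff₀ hp]
  calc _ ≤ (2 : ℝ) ^ N * laplace N u := by linarith
    _ ≤ 2 ^ N * (200000 / u) := by gcongr; exact laplace_le_div hN hu huN
    _ ≤ (2 * (2 ^ N - 2)) * (200000 / u) := by gcongr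
    _ = _ := by ring

theorem abs_exp_neg_sub_condLaplace_div_le (hN : 3 ≤ N) {u : ℝ} (hu : 0 < u) (huN : u ≤ N ^ 2) :
    |(Real.exp (-u) - condLaplace N u) / u| ≤ 2 * 400000 * (1 + u ^ 2)⁻¹ := by
  have h0 := condLaplace_nonneg (N := N) (by omega) u
  refine abs_div_le_inv_one_add_sq hu (fun _ => ?_) (fun _ => ?_)
  · have h1 := Real.add_one_le_exp (-u)
    have h2 := one_sub_condLaplace_le hN hu.le
    have h3 := condLaplace_le_one (N := N) (by omega) hu.le
    have h4 : Real.exp (-u) ≤ 1 := Real.exp_le_one_iff.2 (by linarith)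
    rw [abs_le]
    constructor <;> linarith
  · have h1 := exp_neg_le_inv hu
    have h2 := condLaplace_le_div hN hu huN
    have h3 := Real.exp_pos (-u)
    have h4 : u⁻¹ ≤ 400000 / u := by rw [← one_div]; gcongr; norm_num
    rw [abs_le]
    constructor <;> linarith

theorem sum_exp_neg_sub_div (hN : 2 ≤ N) (u : ℝ) :
    (∑ ε ∈ nonconstSigns N, (Real.exp (-u) - Real.exp (-(u * energy ε))) / u) / (2 ^ N - 2) =
      (Real.exp (-u) - condLaplace N u) / u := by
  have hp := (two_pow_sub_two_pos hN).ne'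
  rw [← Finset.sum_div, Finset.sum_sub_distrib, Finset.sum_const, nsmul_eq_mul,
    card_nonconstSigns hN, condLaplace]
  field_simp

theorem integrableOn_exp_neg_sub_condLaplace_div (hN : 2 ≤ N)
    (hpos : ∀ ε ∈ nonconstSigns N, 0 < energy ε) :
    IntegrableOn (fun u : ℝ => (Real.exp (-u) - condLaplace N u) / u) (Ioi 0) := by
  simp_rw [← sum_exp_neg_sub_div hN]
  exact (integrable_finsetSum _ fun ε hε =>
    integrableOn_exp_neg_sub_exp_neg_mul_div (hpos ε hε)).div_const _

theorem meanLogEnergy_eq_integral (hN : 2 ≤ N) (hpos : ∀ ε ∈ nonconstSigns N, 0 < energy ε) :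
    meanLogEnergy N = ∫ u in Ioi (0 : ℝ), (Real.exp (-u) - condLaplace N u) / u := by
  simp_rw [← sum_exp_neg_sub_div hN]
  rw [integral_div, integral_finsetSum _ fun ε hε =>
    integrableOn_exp_neg_sub_exp_neg_mul_div (hpos ε hε), meanLogEnergy]
  congr 1
  exact Finset.sum_congr rfl fun ε hε => (integral_exp_neg_sub_exp_neg_mul_div (hpos ε hε)).symm

/-- Beyond `u = N ^ 2` the Laplace transform is not controlled by Fourier analysis; there the lower
bound for the energy costs only a factor logarithmic in that bound. -/
theorem abs_integral_tail_le (hN : 3 ≤ N)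
    (hlow : ∀ ε ∈ nonconstSigns N, 1 ≤ (N : ℝ) ^ (2 * N + 1) * energy ε) :
    |∫ u in Ioi ((N : ℝ) ^ 2), (Real.exp (-u) - condLaplace N u) / u| ≤
      1 / (N : ℝ) ^ 2 + 400000 / (N : ℝ) ^ 2 * ((2 * N + 1) * Real.log N + 1) := by
  have hN1 : (1 : ℝ) ≤ N := by exact_mod_cast NeZero.pos N
  have hN0 : (0 : ℝ) < N := by linarith
  have hp := two_pow_sub_two_pos (N := N) (by omega)
  set U : ℝ := (N : ℝ) ^ 2 with hU
  set V : ℝ := (N : ℝ) ^ (2 * N + 1) with hV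
  have hU0 : 0 < U := by positivity
  have hU1 : 1 ≤ U := one_le_pow₀ hN1
  have hV0 : 0 < V := by positivity
  have hUV : U ≤ V := pow_le_pow_right₀ hN1 (by omega)
  have hpos : ∀ ε ∈ nonconstSigns N, 0 < energy ε := fun ε hε =>
    pos_of_mul_pos_right (one_pos.trans_le (hlow ε hε)) hV0.le
  have hlog : Real.log (V / U) ≤ (2 * N + 1) * Real.log N := by
    calc _ ≤ Real.log V := Real.log_le_log (by positivity) (div_le_self hV0.le hU1)
      _ = _ := by rw [hV, Real.log_pow]; push_cast; ring
  have hlog0 : 0 ≤ Real.log N := Real.log_nonneg hN1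
  have hi1 : IntegrableOn (fun u : ℝ => Real.exp (-u) / u) (Ioi U) := by
    simpa using integrableOn_exp_neg_mul_div one_pos hU0
  have hsum (u : ℝ) : condLaplace N u / u =
      (∑ ε ∈ nonconstSigns N, Real.exp (-(u * energy ε)) / u) / (2 ^ N - 2) := by
    rw [condLaplace, ← Finset.sum_div]; ring
  have hi2 : IntegrableOn (fun u : ℝ => condLaplace N u / u) (Ioi U) := by
    simp_rw [hsum]
    exact (integrable_finsetSum _ fun ε hε =>
      integrableOn_exp_neg_mul_div (hpos ε hε) hU0).div_const _
  have h1 : ∫ u in Ioi U, Real.exp (-u) / u ≤ 1 / U := by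
    have := integral_exp_neg_mul_div_le one_pos hU0 le_rfl
    simp only [mul_one, div_self hU0.ne', Real.log_one, zero_add] at this
    refine this.trans (mul_le_of_le_one_left (by positivity) ?_)
    exact Real.exp_le_one_iff.2 (by linarith)
  -- As `V * energy ε ≥ 1`, the range beyond `V` contributes at most `1` to the second factor.
  have h2 : ∫ u in Ioi U, condLaplace N u / u ≤
      400000 / U * ((2 * N + 1) * Real.log N + 1) := by
    simp_rw [hsum]
    rw [integral_div, integral_finsetSum _ fun ε hε =>
      integrableOn_exp_neg_mul_div (hpos ε hε) hU0]
    calc _ ≤ (∑ ε ∈ nonconstSigns N,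
          Real.exp (-(U * energy ε)) * ((2 * N + 1) * Real.log N + 1)) / (2 ^ N - 2) := by
          gcongr with ε hε
          refine (integral_exp_neg_mul_div_le (hpos ε hε) hU0 hUV).trans ?_
          gcongr
          rw [div_le_one (one_pos.trans_le (hlow ε hε))]
          exact hlow ε hε
      _ = condLaplace N U * ((2 * N + 1) * Real.log N + 1) := by
          rw [← Finset.sum_mul, condLaplace]; ring
      _ ≤ _ := by
          gcongr
          exact condLaplace_le_div hN hU0 le_rfl
  have h3 : 0 ≤ ∫ u in Ioi U, Real.exp (-u) / u :=
    setIntegral_nonneg measurableSet_Ioi fun u (hu : U < u) =>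
      div_nonneg (Real.exp_pos _).le (hU0.trans hu).le
  have h4 : 0 ≤ ∫ u in Ioi U, condLaplace N u / u :=
    setIntegral_nonneg measurableSet_Ioi fun u (hu : U < u) =>
      div_nonneg (condLaplace_nonneg (by omega) _) (hU0.trans hu).le
  simp_rw [sub_div]
  rw [integral_sub hi1 hi2, abs_le]
  have h5 : 0 ≤ 1 / U := by positivity
  constructor <;> linarith

end conditioned

theorem tendsto_condLaplace {u : ℝ} (hu : 0 ≤ u) :
    Tendsto (fun n : ℕ => condLaplace (n + 1) u) atTop (𝓝 (1 / (1 + u))) := by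
  have hpow : Tendsto (fun n : ℕ => 2 * (1 / 2 : ℝ) ^ (n + 1)) atTop (𝓝 0) := by
    have h := ((tendsto_pow_atTop_nhds_zero_of_lt_one (r := (1 / 2 : ℝ))
      (by norm_num) (by norm_num)).comp (tendsto_add_atTop_nat 1)).const_mul 2
    rwa [mul_zero] at h
  have h := ((tendsto_laplace hu).sub hpow).div (tendsto_const_nhds.sub hpow)
    (show (1 : ℝ) - 0 ≠ 0 by norm_num)
  rw [sub_zero, sub_zero, div_one] at h
  refine h.congr' ?_
  filter_upwards [eventually_ge_atTop 1] with n hn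
  have hp := (two_pow_sub_two_pos (N := n + 1) (by omega)).ne'
  rw [condLaplace_eq (by omega)]
  simp only [Pi.div_apply, one_div, inv_pow]
  have h2 : (1 : ℝ) - 2 * (2 ^ (n + 1))⁻¹ ≠ 0 := by
    intro h0
    apply hp
    field_simp at h0
    linarith
  rw [div_eq_div_iff h2 hp]
  field_simp

theorem tendsto_integral_truncated :
    Tendsto (fun n : ℕ => ∫ u in Ioi (0 : ℝ), (Iic (((n + 1 : ℕ) : ℝ) ^ 2)).indicator
      (fun u => (Real.exp (-u) - condLaplace (n + 1) u) / u) u) atTop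
      (𝓝 (-Real.eulerMascheroniConstant)) := by
  rw [← integral_exp_neg_sub_inv_div]
  refine tendsto_integral_filter_of_dominated_convergence
    (fun u : ℝ => 2 * 400000 * (1 + u ^ 2)⁻¹) ?_ ?_
    (integrable_inv_one_add_sq.const_mul _).integrableOn ?_
  · refine Eventually.of_forall fun n => ?_
    have hm : Measurable fun u : ℝ => (Real.exp (-u) - condLaplace (n + 1) u) / u := by
      unfold condLaplace
      fun_prop
    exact (hm.indicator measurableSet_Iic).aestronglyMeasurable
  · filter_upwards [eventually_ge_atTop 2] with n hn
    filter_upwards [ae_restrict_mem measurableSet_Ioi] with u (hu : 0 < u)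
    by_cases h : u ∈ Iic (((n + 1 : ℕ) : ℝ) ^ 2)
    · rw [indicator_of_mem h]
      exact abs_exp_neg_sub_condLaplace_div_le (by omega) hu h
    · rw [indicator_of_notMem h, norm_zero]
      positivity
  · filter_upwards [ae_restrict_mem measurableSet_Ioi] with u (hu : 0 < u)
    refine (((tendsto_condLaplace hu.le).const_sub (Real.exp (-u))).div_const u).congr' ?_
    filter_upwards [eventually_ge_atTop ⌈u⌉₊] with n hn
    rw [indicator_of_mem]
    have h1 : u ≤ n := Nat.ceil_le.1 hn
    push_cast
    rw [mem_Iic]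
    nlinarith

theorem tendsto_log_div_self : Tendsto (fun x : ℝ => Real.log x / x) atTop (𝓝 0) := by
  simpa using Real.tendsto_pow_log_div_mul_add_atTop 1 0 1 one_ne_zero

theorem tendsto_tail_bound :
    Tendsto (fun n : ℕ => 1 / ((n + 1 : ℕ) : ℝ) ^ 2 + 400000 / ((n + 1 : ℕ) : ℝ) ^ 2 *
      ((2 * ((n + 1 : ℕ) : ℝ) + 1) * Real.log ((n + 1 : ℕ) : ℝ) + 1)) atTop (𝓝 0) := by
  suffices h : Tendsto (fun x : ℝ => 1 / x ^ 2 + 400000 / x ^ 2 *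
      ((2 * x + 1) * Real.log x + 1)) atTop (𝓝 0) from
    h.comp (tendsto_natCast_atTop_atTop.comp (tendsto_add_atTop_nat 1))
  have h1 : Tendsto (fun x : ℝ => x⁻¹) atTop (𝓝 0) := tendsto_inv_atTop_zero
  have h2 := tendsto_log_div_self
  have h3 := (((h1.mul h1).const_mul 400001).add (h2.const_mul 800000)).add
    ((h2.mul h1).const_mul 400000)
  simp only [mul_zero, add_zero] at h3
  refine h3.congr' ?_
  filter_upwards [eventually_gt_atTop 0] with x hx
  field_simp
  ring

/-- If the energies of the nonconstant patterns are not superexponentially small, then the mean of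
`log energy` approaches `-γ`, the mean of the logarithm of a standard exponential variable. -/
theorem eventually_abs_meanLogEnergy_add_le {δ : ℝ} (hδ : 0 < δ) :
    ∀ᶠ n : ℕ in atTop, (∀ ε ∈ nonconstSigns (n + 1),
      1 ≤ ((n + 1 : ℕ) : ℝ) ^ (2 * (n + 1) + 1) * energy ε) →
      |meanLogEnergy (n + 1) + Real.eulerMascheroniConstant| ≤ δ := by
  have h1 := (Metric.tendsto_nhds.1 tendsto_integral_truncated) (δ / 2) (by linarith)
  have h2 := tendsto_tail_bound.eventually_le_const (show (0 : ℝ) < δ / 2 by linarith)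
  filter_upwards [h1, h2, eventually_ge_atTop 2] with n hn1 hn2 hn3 hlow
  have hpos : ∀ ε ∈ nonconstSigns (n + 1), 0 < energy ε := fun ε hε =>
    pos_of_mul_pos_right (one_pos.trans_le (hlow ε hε)) (by positivity)
  have htail := (abs_integral_tail_le (N := n + 1) (by omega) hlow).trans hn2
  rw [meanLogEnergy_eq_integral (by omega) hpos]
  have hint := integrableOn_exp_neg_sub_condLaplace_div (N := n + 1) (by omega) hpos
  set U : ℝ := ((n + 1 : ℕ) : ℝ) ^ 2 with hU
  have hU0 : 0 ≤ U := by positivity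
  rw [setIntegral_indicator measurableSet_Iic, Ioi_inter_Iic, Real.dist_eq, sub_neg_eq_add] at hn1
  rw [← Ioc_union_Ioi_eq_Ioi hU0, setIntegral_union (Ioc_disjoint_Ioi le_rfl) measurableSet_Ioi
    (hint.mono_set Ioc_subset_Ioi_self) (hint.mono_set (Ioi_subset_Ioi hU0))]
  rw [abs_le] at htail ⊢
  rw [abs_lt] at hn1
  constructor <;> linarith

/-! ### Binary elements of the cyclotomic ring and their norms -/

/-- The element `∑ (ε_k - 1) / 2 * ζ ^ k` of `ℤ[ζ]`, which has integral coefficients and equals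
`∑ ε_k / 2 * ζ ^ k` for prime `N`, because the powers of `ζ` then sum to zero. -/
noncomputable def binaryElt {N : ℕ} [NeZero N] (ε : ZMod N → ℤˣ) : BitRetrieval.O N :=
  ∑ k, ((if ε k = 1 then 0 else -1 : ℤ) : BitRetrieval.O N) *
    AdjoinRoot.root (cyclotomic N ℤ) ^ k.val

section binary

variable {N : ℕ}

theorem half_sign_sub_one (δ : ℤˣ) :
    ((if δ = 1 then 0 else -1 : ℤ) : ℝ) = ((δ : ℤ) : ℝ) / 2 - 1 / 2 := by
  rcases Int.units_eq_one_or δ with rfl | rfl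
  · norm_num
  · rw [if_neg (by decide)]; norm_num

theorem sigma_root [NeZero N] (j : (ZMod N)ˣ) :
    BitRetrieval.sigma N j (AdjoinRoot.root (cyclotomic N ℤ)) =
      ZMod.stdAddChar (j : ZMod N) := by
  rw [BitRetrieval.sigma, AdjoinRoot.lift_root, ZMod.stdAddChar_apply, ZMod.toCircle_apply,
    mul_div_assoc]

theorem isPrimitiveRoot_stdAddChar [NeZero N] (j : (ZMod N)ˣ) :
    IsPrimitiveRoot (ZMod.stdAddChar (j : ZMod N) : ℂ) N := by
  have h := Complex.isPrimitiveRoot_exp_of_coprime (j : ZMod N).val N (NeZero.ne N)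
    (ZMod.val_coe_unit_coprime j)
  rwa [← mul_div_assoc, ← ZMod.toCircle_apply, ← ZMod.stdAddChar_apply] at h

theorem stdAddChar_units_injective [NeZero N] :
    Function.Injective fun j : (ZMod N)ˣ => (ZMod.stdAddChar (j : ZMod N) : ℂ) :=
  ZMod.injective_stdAddChar.comp Units.val_injective

theorem sigma_mk [NeZero N] (j : (ZMod N)ˣ) (p : ℤ[X]) :
    BitRetrieval.sigma N j (AdjoinRoot.mk (cyclotomic N ℤ) p) =
      aeval (ZMod.stdAddChar (j : ZMod N) : ℂ) p := by
  rw [← sigma_root, BitRetrieval.sigma, AdjoinRoot.lift_mk, AdjoinRoot.lift_root]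
  rfl

theorem sigma_injective [NeZero N] (j : (ZMod N)ˣ) :
    Function.Injective (BitRetrieval.sigma N j) := by
  rw [injective_iff_map_eq_zero]
  intro a ha
  obtain ⟨p, rfl⟩ := AdjoinRoot.mk_surjective a
  rw [sigma_mk] at ha
  have hprim := isPrimitiveRoot_stdAddChar j
  rw [AdjoinRoot.mk_eq_zero, cyclotomic_eq_minpoly hprim (NeZero.pos N)]
  exact minpoly.isIntegrallyClosed_dvd (hprim.isIntegral (NeZero.pos N)) ha

/-- The norm of an element of `ℤ[ζ]` is a rational integer: it is the resultant of the cyclotomic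
polynomial with any polynomial representing the element. -/
theorem exists_int_eq_prod_sigma [NeZero N] (a : BitRetrieval.O N) :
    ∃ m : ℤ, (m : ℂ) = ∏ j : (ZMod N)ˣ, BitRetrieval.sigma N j a := by
  obtain ⟨p, rfl⟩ := AdjoinRoot.mk_surjective a
  refine ⟨resultant (cyclotomic N ℤ) p, ?_⟩
  have hroots : (cyclotomic N ℂ).roots =
      (Finset.univ.image fun j : (ZMod N)ˣ => (ZMod.stdAddChar (j : ZMod N) : ℂ)).val := by
    rw [cyclotomic.roots_eq_primitiveRoots_val]
    congr 1
    refine (Finset.eq_of_subset_of_card_le ?_ ?_).symm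
    · intro z hz
      obtain ⟨j, -, rfl⟩ := Finset.mem_image.1 hz
      exact (mem_primitiveRoots (NeZero.pos N)).2 (isPrimitiveRoot_stdAddChar j)
    · rw [Finset.card_image_of_injective _ stdAddChar_units_injective, Finset.card_univ,
        ZMod.card_units_eq_totient, Complex.card_primitiveRoots]
  have h := resultant_eq_prod_eval (cyclotomic N ℂ) (p.map (Int.castRingHom ℂ)) p.natDegree
    natDegree_map_le (IsAlgClosed.splits _)
  rw [(cyclotomic.monic N ℂ).leadingCoeff, one_pow, one_mul, hroots, ← map_cyclotomic_int N ℂ,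
    resultant_map_map, natDegree_map_eq_of_injective Int.cast_injective] at h
  rw [← eq_intCast (Int.castRingHom ℂ), h]
  simp_rw [sigma_mk]
  change ∏ x ∈ Finset.univ.image fun j : (ZMod N)ˣ => (ZMod.stdAddChar (j : ZMod N) : ℂ), _ = _
  rw [Finset.prod_image stdAddChar_units_injective.injOn]
  refine Finset.prod_congr rfl fun j _ => ?_
  rw [eval_map, aeval_def]
  rfl

theorem one_le_prod_norm_sigma [NeZero N] {a : BitRetrieval.O N} (ha : a ≠ 0) :
    1 ≤ ∏ j : (ZMod N)ˣ, ‖BitRetrieval.sigma N j a‖ := by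
  obtain ⟨m, hm⟩ := exists_int_eq_prod_sigma a
  rw [← norm_prod, ← hm, Complex.norm_intCast]
  have hm0 : m ≠ 0 := by
    rintro rfl
    rw [Int.cast_zero, eq_comm, Finset.prod_eq_zero_iff] at hm
    obtain ⟨j, -, hj⟩ := hm
    exact ha ((map_eq_zero_iff _ (sigma_injective j)).1 hj)
  exact_mod_cast Int.one_le_abs hm0

theorem log_algNorm [NeZero N] {a : BitRetrieval.O N} (ha : a ≠ 0) :
    Real.log (BitRetrieval.algNorm N a) =
      ∑ j : (ZMod N)ˣ, Real.log ‖BitRetrieval.sigma N j a‖ := by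
  have h := congrArg norm (BitRetrieval.coe_algNorm N a)
  rw [Complex.norm_real, Real.norm_eq_abs, norm_prod] at h
  rw [← Real.log_abs, h, Real.log_prod]
  intro j _
  exact norm_ne_zero_iff.2 ((map_ne_zero_iff _ (sigma_injective j)).2 ha)

/-- The `j`th conjugate of a binary element is half the signed sum of the permuted pattern. -/
theorem sigma_binaryElt [NeZero N] (hN : 2 ≤ N) (j : (ZMod N)ˣ) (ε : ZMod N → ℤˣ) :
    BitRetrieval.sigma N j (binaryElt ε) =
      signSum (fun k => ε (((j⁻¹ : (ZMod N)ˣ) : ZMod N) * k)) / 2 := by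
  have : Fact (1 < N) := ⟨hN⟩
  have hpow (k : ZMod N) : (ZMod.stdAddChar (j : ZMod N) : ℂ) ^ k.val =
      ZMod.stdAddChar ((j : ZMod N) * k) := by
    rw [← AddChar.map_nsmul_eq_pow, nsmul_eq_mul, ZMod.natCast_zmod_val, mul_comm]
  have hcoef (δ : ℤˣ) :
      ((if δ = 1 then 0 else -1 : ℤ) : ℂ) = ((δ : ℤ) : ℂ) / 2 - 1 / 2 := by
    rw [← Complex.ofReal_intCast, half_sign_sub_one]
    push_cast
    rfl
  rw [binaryElt, map_sum]
  simp_rw [map_mul, map_intCast, map_pow, sigma_root, hpow, hcoef, sub_mul]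
  rw [Finset.sum_sub_distrib, ← Finset.mul_sum, sum_stdAddChar_mul (Units.ne_zero j), mul_zero,
    sub_zero, signSum, Finset.sum_div]
  refine Fintype.sum_equiv j.mulLeft _ _ fun k => ?_
  rw [Units.mulLeft_apply, Units.inv_mul_cancel_left]
  ring

theorem sum_root_pow (hN : N.Prime) (A : Type*) [CommRing A] [NeZero N] :
    ∑ k : ZMod N, AdjoinRoot.root (cyclotomic N A) ^ k.val = 0 := by
  have : Fact N.Prime := ⟨hN⟩
  have h : AdjoinRoot.mk (cyclotomic N A) (∑ i ∈ Finset.range N, X ^ i) = 0 := by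
    rw [AdjoinRoot.mk_eq_zero, cyclotomic_prime]
  rw [map_sum] at h
  rw [← h, ← Fin.sum_univ_eq_sum_range (fun i => AdjoinRoot.mk (cyclotomic N A) (X ^ i))]
  obtain ⟨n, rfl⟩ : ∃ n, N = n + 1 := ⟨N - 1, by have := hN.pos; omega⟩
  refine Finset.sum_congr rfl fun k _ => ?_
  rw [map_pow, AdjoinRoot.mk_X]
  rfl

/-- The only relation among the `N`th roots of unity for prime `N`. -/
theorem coeff_eq_of_sum_root_pow_eq_zero [NeZero N] (hN : N.Prime) (a : ZMod N → ℤ)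
    (h : ∑ k, (a k : BitRetrieval.O N) * AdjoinRoot.root (cyclotomic N ℤ) ^ k.val = 0)
    (k l : ZMod N) : a k = a l := by
  have : Fact N.Prime := ⟨hN⟩
  set p : ℤ[X] := ∑ k : ZMod N, C (a k) * X ^ k.val with hp
  have hcoeff (k : ZMod N) : p.coeff k.val = a k := by
    rw [hp, finsetSum_coeff, Finset.sum_eq_single k]
    · simp
    · intro l _ hl
      rw [coeff_C_mul_X_pow, if_neg]
      exact fun h => hl (ZMod.val_injective N h.symm)
    · simp
  have hdeg : p.natDegree ≤ N - 1 := by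
    refine natDegree_sum_le_of_forall_le _ _ fun k _ => (natDegree_C_mul_X_pow_le _ _).trans ?_
    have := ZMod.val_lt k
    omega
  have hdvd : cyclotomic N ℤ ∣ p := by
    rw [← AdjoinRoot.mk_eq_zero, hp, map_sum, ← h]
    refine Finset.sum_congr rfl fun k _ => ?_
    rw [map_mul, map_pow, AdjoinRoot.mk_X, AdjoinRoot.mk_C, eq_intCast]
  obtain ⟨q, hq⟩ := hdvd
  have hqdeg : q.natDegree = 0 := by
    rcases eq_or_ne q 0 with rfl | hq0
    · simp
    · have := (cyclotomic.monic N ℤ).natDegree_mul' hq0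
      rw [← hq, natDegree_cyclotomic, Nat.totient_prime hN] at this
      omega
  rw [eq_C_of_natDegree_eq_zero hqdeg, cyclotomic_prime, mul_comm] at hq
  have hconst (k : ZMod N) : a k = q.coeff 0 := by
    rw [← hcoeff, hq, coeff_C_mul, finsetSum_coeff]
    simp [coeff_X_pow, ZMod.val_lt k]
  rw [hconst, hconst]

theorem notMem_nonconstSigns_of_forall_eq {ε : ZMod N → ℤˣ} (h : ∀ k, ε k = ε 0) [NeZero N] :
    ε ∉ nonconstSigns N := by
  rw [nonconstSigns, Finset.mem_compl, not_not, Finset.mem_insert, Finset.mem_singleton]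
  rcases Int.units_eq_one_or (ε 0) with h0 | h0
  · exact Or.inl (funext fun k => (h k).trans h0)
  · exact Or.inr (funext fun k => (h k).trans h0)

theorem binaryElt_ne_zero_iff [NeZero N] (hN : N.Prime) (ε : ZMod N → ℤˣ) :
    binaryElt ε ≠ 0 ↔ ε ∈ nonconstSigns N := by
  constructor
  · intro h
    rw [nonconstSigns, Finset.mem_compl, Finset.mem_insert, Finset.mem_singleton]
    rintro (rfl | rfl)
    · exact h (by simp [binaryElt])
    · refine h ?_
      have h1 (k : ZMod N) : (-1 : ZMod N → ℤˣ) k ≠ 1 := by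
        change (-1 : ℤˣ) ≠ 1
        decide
      simp only [binaryElt, if_neg (h1 _)]
      rw [← Finset.mul_sum, sum_root_pow hN, mul_zero]
  · intro hε h
    refine notMem_nonconstSigns_of_forall_eq (fun k => ?_) hε
    have := coeff_eq_of_sum_root_pow_eq_zero hN _ h k 0
    rcases Int.units_eq_one_or (ε k) with h1 | h1 <;>
      rcases Int.units_eq_one_or (ε 0) with h2 | h2 <;> simp_all

theorem binaryElt_injOn [NeZero N] (hN : N.Prime) :
    InjOn (binaryElt (N := N)) (nonconstSigns N) := by
  intro ε hε ε' hε' h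
  have h0 := coeff_eq_of_sum_root_pow_eq_zero hN
    (fun k => (if ε k = 1 then 0 else -1) - (if ε' k = 1 then 0 else -1)) (by
      rw [binaryElt, binaryElt, ← sub_eq_zero, ← Finset.sum_sub_distrib] at h
      rw [← h]
      refine Finset.sum_congr rfl fun k _ => ?_
      push_cast
      ring)
  by_contra hne
  obtain ⟨l, hl⟩ := Function.ne_iff.1 hne
  -- Where the patterns differ their coefficients differ by a fixed `±1`, which pins both patterns.
  refine notMem_nonconstSigns_of_forall_eq (fun k => ?_) hε
  have h1 := h0 k l
  have h2 := h0 0 l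
  rcases Int.units_eq_one_or (ε k) with a1 | a1 <;>
    rcases Int.units_eq_one_or (ε' k) with a2 | a2 <;>
    rcases Int.units_eq_one_or (ε l) with a3 | a3 <;>
    rcases Int.units_eq_one_or (ε' l) with a4 | a4 <;>
    rcases Int.units_eq_one_or (ε 0) with a5 | a5 <;>
    rcases Int.units_eq_one_or (ε' 0) with a6 | a6 <;> simp_all

theorem toRQuot_injective (N : ℕ) : Function.Injective (BitRetrieval.toRQuot N) := by
  rw [injective_iff_map_eq_zero]
  intro a ha
  obtain ⟨p, rfl⟩ := AdjoinRoot.mk_surjective a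
  have h : BitRetrieval.toRQuot N (AdjoinRoot.mk (cyclotomic N ℤ) p) =
      AdjoinRoot.mk (cyclotomic N ℝ) (p.map (Int.castRingHom ℝ)) := by
    have e : Int.castRingHom (BitRetrieval.RQuot N) =
        (AdjoinRoot.of (cyclotomic N ℝ)).comp (Int.castRingHom ℝ) := RingHom.ext_int _ _
    rw [BitRetrieval.toRQuot, AdjoinRoot.lift_mk, e, ← eval₂_map, ← AdjoinRoot.aeval_eq]
    rfl
  rw [h, AdjoinRoot.mk_eq_zero, ← map_cyclotomic_int,
    map_dvd_map _ Int.cast_injective (cyclotomic.monic N ℤ)] at ha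
  exact AdjoinRoot.mk_eq_zero.2 ha

theorem Psi_sum_signs [NeZero N] (hN : N.Prime) (ε : ZMod N → ℤˣ) (c : ZMod N → ℝ)
    (hc : ∀ k, c k = ((ε k : ℤ) : ℝ) / 2) :
    BitRetrieval.Psi N (∑ k, c k • AdjoinRoot.root (X ^ N - 1 : ℝ[X]) ^ k.val) =
      BitRetrieval.toRQuot N (binaryElt ε) := by
  rw [map_sum, binaryElt, map_sum]
  have h1 (k : ZMod N) : BitRetrieval.Psi N
      (c k • AdjoinRoot.root (X ^ N - 1 : ℝ[X]) ^ k.val) =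
      AdjoinRoot.of _ (c k) * AdjoinRoot.root (cyclotomic N ℝ) ^ k.val := by
    rw [Algebra.smul_def, AdjoinRoot.algebraMap_eq, map_mul, map_pow, BitRetrieval.Psi,
      AdjoinRoot.lift_of, AdjoinRoot.lift_root]
  have h2 (k : ZMod N) : BitRetrieval.toRQuot N
      (((if ε k = 1 then 0 else -1 : ℤ) : BitRetrieval.O N) *
        AdjoinRoot.root (cyclotomic N ℤ) ^ k.val) =
      AdjoinRoot.of _ (c k) * AdjoinRoot.root (cyclotomic N ℝ) ^ k.val -
        AdjoinRoot.of _ (1 / 2) * AdjoinRoot.root (cyclotomic N ℝ) ^ k.val := by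
    have h3 : ((if ε k = 1 then 0 else -1 : ℤ) : BitRetrieval.RQuot N) =
        AdjoinRoot.of (cyclotomic N ℝ) ((if ε k = 1 then 0 else -1 : ℤ) : ℝ) :=
      (map_intCast _ _).symm
    rw [map_mul, map_pow, map_intCast, h3, half_sign_sub_one, ← hc, map_sub, sub_mul,
      BitRetrieval.toRQuot, AdjoinRoot.lift_root]
  simp_rw [h1, h2]
  rw [Finset.sum_sub_distrib, ← Finset.mul_sum, sum_root_pow hN, mul_zero, sub_zero]

theorem binaryO_eq_image [NeZero N] (hN : N.Prime) :
    BitRetrieval.binaryO N = binaryElt '' (nonconstSigns N : Set (ZMod N → ℤˣ)) := by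
  have hsum (c : ZMod N → ℝ) :
      ∑ i : Fin N, c (ZMod.finEquiv N i) • AdjoinRoot.root (X ^ N - 1 : ℝ[X]) ^ (i : ℕ) =
        ∑ k, c k • AdjoinRoot.root (X ^ N - 1 : ℝ[X]) ^ k.val := by
    refine Fintype.sum_equiv (ZMod.finEquiv N).toEquiv _ _ fun i => ?_
    obtain ⟨n, rfl⟩ : ∃ n, N = n + 1 := ⟨N - 1, by have := hN.pos; omega⟩
    rfl
  ext b
  constructor
  · rintro ⟨_, ⟨⟨c, hc, rfl⟩, hne⟩, hb⟩
    set c' : ZMod N → ℝ := fun k => c ((ZMod.finEquiv N).symm k) with hc'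
    have hcc : ∀ i, c i = c' (ZMod.finEquiv N i) := fun i => by simp [hc']
    simp_rw [hcc] at hne hb
    rw [hsum] at hne hb
    set ε : ZMod N → ℤˣ := fun k => if c' k = 1 / 2 then 1 else -1 with hε
    have hval : ∀ k, c' k = ((ε k : ℤ) : ℝ) / 2 := by
      intro k
      rcases hc ((ZMod.finEquiv N).symm k) with h | h
      · have h' : c' k = 1 / 2 := h
        simp [hε, h']
      · have h' : c' k = -(1 / 2) := h
        have h'' : ¬ (-(1 / 2 : ℝ) = 1 / 2) := by norm_num
        simp only [hε, h', if_neg h'']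
        norm_num
    rw [Psi_sum_signs hN ε c' hval] at hne hb
    refine ⟨ε, ?_, (toRQuot_injective N hb).symm⟩
    rw [Finset.mem_coe, ← binaryElt_ne_zero_iff hN]
    exact fun h => hne (by rw [h, map_zero])
  · rintro ⟨ε, hε, rfl⟩
    have hPsi := Psi_sum_signs hN ε (fun k => ((ε k : ℤ) : ℝ) / 2) fun _ => rfl
    refine ⟨_, ⟨⟨fun i => ((ε (ZMod.finEquiv N i) : ℤ) : ℝ) / 2, fun i => ?_, rfl⟩, ?_⟩, ?_⟩
    · beta_reduce
      rcases Int.units_eq_one_or (ε (ZMod.finEquiv N i)) with h | h <;> rw [h]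
      · left; norm_num
      · right; norm_num
    · rw [hsum fun k => ((ε k : ℤ) : ℝ) / 2, hPsi, map_ne_zero_iff _ (toRQuot_injective N),
        binaryElt_ne_zero_iff hN]
      exact hε
    · rw [hsum fun k => ((ε k : ℤ) : ℝ) / 2, hPsi]

/-! ### The expectation of the logarithm of the norm -/

theorem integral_uniformOn_finset {Ω : Type*} [MeasurableSpace Ω] [MeasurableSingletonClass Ω]
    (s : Finset Ω) (f : Ω → ℝ) :
    ∫ x, f x ∂(ProbabilityTheory.uniformOn (s : Set Ω)) = (∑ x ∈ s, f x) / s.card := by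
  have hint : IntegrableOn f s Measure.count := by
    rw [← Set.biUnion_of_singleton (s : Set Ω)]
    exact (integrableOn_finset_iUnion (s := s)).2 fun x _ => integrableOn_singleton (hx := by simp)
  rw [ProbabilityTheory.uniformOn, ProbabilityTheory.cond, integral_smul_measure,
    setIntegral_finset s hint, Measure.count_apply_finset, div_eq_inv_mul]
  simp [measureReal_def]

theorem norm_signSum_le [NeZero N] (ε : ZMod N → ℤˣ) : ‖signSum ε‖ ≤ N := by
  calc _ ≤ ∑ k : ZMod N, ‖((ε k : ℤ) : ℂ) * ZMod.stdAddChar k‖ := norm_sum_le _ _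
    _ = ∑ k : ZMod N, (1 : ℝ) := by
        refine Finset.sum_congr rfl fun k _ => ?_
        rw [norm_mul, norm_stdAddChar, mul_one]
        rcases Int.units_eq_one_or (ε k) with h | h <;> simp [h]
    _ = N := by simp

/-- All conjugates are at most `N` and their product is at least `1`, so none is tiny. -/
theorem one_le_pow_mul_energy [NeZero N] (hN : N.Prime) {ε : ZMod N → ℤˣ}
    (hε : ε ∈ nonconstSigns N) : 1 ≤ (N : ℝ) ^ (2 * N + 1) * energy ε := by
  have hN1 : (1 : ℝ) ≤ N := by exact_mod_cast hN.pos
  have h := one_le_prod_norm_sigma ((binaryElt_ne_zero_iff hN ε).2 hε)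
  have hb (j : (ZMod N)ˣ) : ‖BitRetrieval.sigma N j (binaryElt ε)‖ ≤ N := by
    rw [sigma_binaryElt hN.two_le, norm_div, Complex.norm_two]
    have := norm_signSum_le fun k => ε (((j⁻¹ : (ZMod N)ˣ) : ZMod N) * k)
    linarith
  have h1 : ‖BitRetrieval.sigma N 1 (binaryElt ε)‖ = ‖signSum ε‖ / 2 := by
    rw [sigma_binaryElt hN.two_le, norm_div, Complex.norm_two]
    simp
  rw [← Finset.mul_prod_erase _ _ (Finset.mem_univ 1), h1] at h
  have h2 : ∏ j ∈ Finset.univ.erase (1 : (ZMod N)ˣ),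
      ‖BitRetrieval.sigma N j (binaryElt ε)‖ ≤ (N : ℝ) ^ N := by
    refine (Finset.prod_le_prod (fun _ _ => norm_nonneg _) fun j _ => hb j).trans ?_
    rw [Finset.prod_const]
    refine pow_le_pow_right₀ hN1 ?_
    refine (Finset.card_erase_le).trans ?_
    rw [Finset.card_univ, ZMod.card_units_eq_totient]
    exact Nat.totient_le N
  have h3 : 1 ≤ ‖signSum ε‖ / 2 * (N : ℝ) ^ N := h.trans (by gcongr)
  have h4 : (N : ℝ) ^ (2 * N + 1) * energy ε = 4 * (‖signSum ε‖ / 2 * (N : ℝ) ^ N) ^ 2 := by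
    rw [energy, pow_succ, pow_mul', mul_pow]
    field_simp
    ring
  rw [h4]
  nlinarith

/-- Every conjugate has the same distribution, as multiplication by `j` permutes the patterns. -/
theorem sum_log_norm_sigma [NeZero N] (hN : N.Prime) (j : (ZMod N)ˣ) :
    ∑ ε ∈ nonconstSigns N, Real.log ‖BitRetrieval.sigma N j (binaryElt ε)‖ =
      ∑ ε ∈ nonconstSigns N, (Real.log (energy ε) + Real.log (N / 4)) / 2 := by
  refine Finset.sum_equiv ((Units.mulLeft j).arrowCongr (Equiv.refl ℤˣ)) (fun ε => ?_)
    fun ε hε => ?_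
  · rw [nonconstSigns, Finset.mem_compl, Finset.mem_compl, Finset.mem_insert, Finset.mem_insert,
      Finset.mem_singleton, Finset.mem_singleton]
    rw [← (Equiv.injective ((Units.mulLeft j).arrowCongr (Equiv.refl ℤˣ))).eq_iff (b := 1),
      ← (Equiv.injective ((Units.mulLeft j).arrowCongr (Equiv.refl ℤˣ))).eq_iff (b := -1)]
    rfl
  · have hne : BitRetrieval.sigma N j (binaryElt ε) ≠ 0 :=
      (map_ne_zero_iff _ (sigma_injective j)).2 ((binaryElt_ne_zero_iff hN ε).2 hε)
    rw [sigma_binaryElt hN.two_le] at hne ⊢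
    have hN0 : (0 : ℝ) < N := by exact_mod_cast hN.pos
    change Real.log ‖signSum ((Units.mulLeft j).arrowCongr (Equiv.refl ℤˣ) ε) / 2‖ = _
    change signSum ((Units.mulLeft j).arrowCongr (Equiv.refl ℤˣ) ε) / 2 ≠ 0 at hne
    set z := signSum ((Units.mulLeft j).arrowCongr (Equiv.refl ℤˣ) ε) with hz
    have hz0 : 0 < ‖z‖ := norm_pos_iff.2 fun h => hne (by rw [h, zero_div])
    rw [energy, ← hz, ← Real.log_mul (by positivity) (by positivity)]
    have : ‖z‖ ^ 2 / N * (N / 4) = ‖z / 2‖ ^ 2 := by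
      rw [norm_div, Complex.norm_two]
      field_simp
      norm_num
    rw [this, Real.log_pow]
    push_cast
    ring

theorem integral_log_algNorm [NeZero N] (hN : N.Prime) :
    ∫ b, Real.log (BitRetrieval.algNorm N b)
      ∂(ProbabilityTheory.uniformOn (BitRetrieval.binaryO N)) =
      ((N : ℝ) - 1) * ((meanLogEnergy N + Real.log (N / 4)) / 2) := by
  classical
  have hp := (two_pow_sub_two_pos hN.two_le).ne'
  have hcard := card_nonconstSigns hN.two_le
  rw [binaryO_eq_image hN, ← Finset.coe_image, integral_uniformOn_finset,
    Finset.sum_image (binaryElt_injOn hN), Finset.card_image_of_injOn (binaryElt_injOn hN), hcard]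
  have h1 : ∑ ε ∈ nonconstSigns N, Real.log (BitRetrieval.algNorm N (binaryElt ε)) =
      ∑ j : (ZMod N)ˣ, ∑ ε ∈ nonconstSigns N,
        Real.log ‖BitRetrieval.sigma N j (binaryElt ε)‖ := by
    rw [Finset.sum_comm]
    exact Finset.sum_congr rfl fun ε hε => log_algNorm ((binaryElt_ne_zero_iff hN ε).2 hε)
  rw [h1]
  simp_rw [sum_log_norm_sigma hN]
  rw [Finset.sum_const, Finset.card_univ, ZMod.card_units_eq_totient, Nat.totient_prime hN,
    ← Finset.sum_div, Finset.sum_add_distrib, Finset.sum_const, nsmul_eq_mul, nsmul_eq_mul, hcard,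
    Nat.cast_sub hN.one_le, Nat.cast_one, meanLogEnergy]
  field_simp

end binary

theorem mainTheorem3 :
    ∀ ε : ℝ, 0 < ε → ∃ N₀ : ℕ, ∀ (N : ℕ) [Fact N.Prime], Odd N → N₀ ≤ N →
      |(∫ b, Real.log (BitRetrieval.algNorm N b)
            ∂(ProbabilityTheory.uniformOn (BitRetrieval.binaryO N)))
          - 1 / 2 * (Real.log ((N : ℝ) / 4) - Real.eulerMascheroniConstant) * (N : ℝ)|
        ≤ ε * (N : ℝ) := by
  intro δ hδ
  have hlog : Tendsto (fun n : ℕ => Real.log ((n + 1 : ℕ) : ℝ) / ((n + 1 : ℕ) : ℝ))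
      atTop (𝓝 0) :=
    tendsto_log_div_self.comp (tendsto_natCast_atTop_atTop.comp (tendsto_add_atTop_nat 1))
  have hev := ((eventually_abs_meanLogEnergy_add_le hδ).and
    (hlog.eventually_le_const (show (0 : ℝ) < δ / 2 by linarith))).and (eventually_ge_atTop 3)
  obtain ⟨n₀, hn₀⟩ := eventually_atTop.1 hev
  refine ⟨n₀ + 1, fun N hfact _ hNn => ?_⟩
  have hN : N.Prime := hfact.out
  obtain ⟨n, rfl⟩ : ∃ n, N = n + 1 := ⟨N - 1, by omega⟩
  -- The factor `N - 1` in place of `N` changes the expectation only by `O(log N)`.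
  obtain ⟨⟨h1, h2⟩, h3⟩ := hn₀ n (by omega)
  have hmean := h1 fun ε hε => one_le_pow_mul_energy hN hε
  rw [integral_log_algNorm hN]
  have hN4 : (4 : ℝ) ≤ ((n + 1 : ℕ) : ℝ) := by exact_mod_cast (by omega : 4 ≤ n + 1)
  set x : ℝ := ((n + 1 : ℕ) : ℝ) with hx
  set M := meanLogEnergy (n + 1) with hM
  have hx0 : 0 < x := by linarith
  have hlogpos : 0 ≤ Real.log (x / 4) :=
    Real.log_nonneg (by rw [le_div_iff₀ (by norm_num)]; linarith)
  have hlogle : Real.log (x / 4) ≤ Real.log x := Real.log_le_log (by positivity) (by linarith)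
  have hlog1 : 1 ≤ Real.log x := by
    rw [Real.le_log_iff_exp_le hx0]
    linarith [Real.exp_one_lt_d9]
  have hγ1 := Real.one_half_lt_eulerMascheroniConstant
  have hγ2 := Real.eulerMascheroniConstant_lt_two_thirds
  rw [div_le_iff₀ hx0] at h2
  set γ := Real.eulerMascheroniConstant
  have hdiff : (x - 1) * ((M + Real.log (x / 4)) / 2) - 1 / 2 * (Real.log (x / 4) - γ) * x =
      ((x - 1) * (M + γ) - (Real.log (x / 4) - γ)) / 2 := by ring
  rw [hdiff, abs_div, abs_two, div_le_iff₀ two_pos]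
  have h4 : |(x - 1) * (M + γ)| ≤ x * δ := by
    rw [abs_mul, abs_of_nonneg (by linarith)]
    gcongr
    linarith
  have h5 : |Real.log (x / 4) - γ| ≤ δ / 2 * x := by
    rw [abs_le]
    constructor <;> linarith
  have hδx : 0 < δ * x := by positivity
  linarith [abs_sub ((x - 1) * (M + γ)) (Real.log (x / 4) - γ)]
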